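/- **Setting.** Let $S$ be a finite set and $R$ a finite set of (unoriented) relations between words of $S^*$, and let $M=\langle S\mid R\rangle^+$ be the monoid they present; write $u\equiv v$ when the words $u,v$ represent the same element of $M$. Assume that the presentation is *right-complemented*: $R$ contains no relation $w=\varepsilon$ with $w\neq\varepsilon$, no relation $s\cdots=s\cdots$ with $s\in S$, and at most one relation $s\cdots=t\cdots$ for $s\ne t$ in $S$. Its syntactic right-complement is the partial map $\theta:S^2\to S^*$ with $\theta(s,s)=\varepsilon$ and, for $s\neq t$, with $\theta(s,t),\theta(t,s)$ defined if and only if $R$ contains a relation $s\cdots=t\cdots$, which is then $s\,\theta(s,t)=t\,\theta(t,s)$. A signed word is a word on $S\cup\overline S$, where $\overline S=\{\overline s : s\in S\}$ is a set of formal inverses; $\overline{w}$ is obtained from $w$ by reversing the order of the letters and exchanging $s$ and $\overline s$. One step of *right-reversing* replaces a factor $\overline s t$ ($s,t\in S$, $\theta(s,t)$ defined) of a signed word by $\theta(s,t)\,\overline{\theta(t,s)}$. Write $\curvearrowright^*$ (resp. $\curvearrowright^+$) for any number of steps (resp. at least one step). Right-reversing is *complete* if, whenever $u\hat v\equiv v\hat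 u$ with $u,v,\hat u,\hat v\in S^*$, there are $u',v',w'\in S^*$ with $\overline u v\curvearrowright^* v'\,\overline{u'}$, $\hat u\equiv u'w'$ and $\hat v\equiv v'w'$. For $u,v\in S^*$, the pair $(u,v)$ is - *failing* if $\overline u v\curvearrowright^* w_1\overline s t w_2$ for some signed words $w_1,w_2$ and letters $s,t\in S$ with $\theta(s,t)$ undefined; - *periodic* if $\overline u v\curvearrowright^+ w_1\overline u v w_2$ for some signed words $w_1,w_2$; - *eventually periodic* if $\overline u v\curvearrowright^* w_1\overline{u'}v'w_2$ for some periodic pair $(u',v')$ and signed words $w_1,w_2$. In a monoid, $a\preccurlyeq b$ ("$b$ is a right-multiple of $a$") means $b=ac$ for some $c$. A *right-lcm* of $a,b$ is an $m$ with $a\preccurlyeq m$, $b\preccurlyeq m$, and $m\preccurlyeq d$ whenever $a\preccurlyeq d$ and $b\preccurlyeq d$. A monoid is *noetherian* if the relation "$b=cad$ for some $c,d$ that are not both invertible" ($a$ is a proper factor of $b$) is well-founded. A subset $G$ of a left-cancellative monoid is a *Garside family* if every element is a product $x_1\cdots x_p$ ($p\ge 0$), where each $x_i$ is invertible or of the form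 $ge$ with $g\in G$ and $e$ invertible, and where for each $i<p$ and all $g\in G$ and all elements $f$, $g\preccurlyeq f x_i x_{i+1}$ implies $g\preccurlyeq f x_i$. **Proposition.** There is one algorithm (a partial recursive function, with letters coded by natural numbers) that takes as input the relations $R$ of a finite right-complemented presentation $\langle S\mid R\rangle^+$ and two words $u,v\in S^*$, and has the following properties. 1. It runs right-reversing and stops when it succeeds or detects failure or eventual periodicity. That is, when it halts, it outputs a right-reversing sequence $w_0\curvearrowright^1 w_1\curvearrowright^1\cdots\curvearrowright^1 w_n$ with $w_0=\overline u v$, together with an answer, and one of the following holds: - $w_n=v'\,\overline{u'}$ with $u',v'\in S^*$, and the answer is the word $uv'$; - $w_n$ has a factor $\overline s t$ with $s,t\in S$ and $\theta(s,t)$ undefined, and the answer is "no common right-multiple"; - for some $i\le n$, $w_i=p\,\overline{u_1}v_1\,q$ and $w_n=p\,x\,\overline{u_1}v_1\,y\,q$ with $u_1,v_1\in S^*$, signed words $p,q,x,y$, and $\overline{u_1}v_1\curvearrowright^+ x\,\overline{u_1}v_1\,y$, and the answer is "no common right-multiple". It halts if and only if $(u,v)$ is failing, or $(u,v)$ is eventually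 periodic, or $\overline u v\curvearrowright^* v'\,\overline{u'}$ for some $u',v'\in S^*$. 2. If moreover right-reversing is complete for $\langle S\mid R\rangle^+$, and $M$ is noetherian and has a finite Garside family, then the algorithm halts for all $u,v\in S^*$, and its answer is correct: either it is a word that represents a right-lcm in $M$ of the elements represented by $u$ and $v$, or it is "no common right-multiple" and these two elements have no common right-multiple in $M$. -/

import Mathlib

namespace RightReversing

section Words

variable {S : Type*}

/-- A signed word on `S`: the pair `(s, true)` is the letter `s`, the pair `(s, false)` is its
formal inverse. -/
abbrev SignedWord (S : Type*) : Type _ := List (S × Bool)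

/-- A positive word, seen as a signed word. -/
def pos (u : List S) : SignedWord S := u.map fun s => (s, true)

/-- The formal inverse of a positive word: the order is reversed and every letter is inverted. -/
def neg (u : List S) : SignedWord S := (u.map fun s => (s, false)).reverse

/-- The signed word `u⁻¹ v`. -/
def frac (u v : List S) : SignedWord S := neg u ++ pos v

/-- A finite list of relations `w = w'` between words on `S`. -/
abbrev Relations (S : Type*) : Type _ := List (List S × List S)

/-- `w = w'` is one of the relations of `R`; a relation is not oriented. -/
def IsRelation (R : Relations S) (w w' : List S) : Prop := (w, w') ∈ R ∨ (w', w) ∈ R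

/-- The presentation `(S, R)` is right-complemented: `R` contains no relation `w = ε` with `w`
nonempty, no relation `s… = s…`, and at most one relation `s… = t…` for `s ≠ t`. -/
structure IsRightComplemented (R : Relations S) : Prop where
  no_eps : ∀ w : List S, IsRelation R w [] → w = []
  no_same : ∀ (s : S) (x y : List S), ¬ IsRelation R (s :: x) (s :: y)
  unique : ∀ (s t : S) (x y x' y' : List S), s ≠ t →
    IsRelation R (s :: x) (t :: y) → IsRelation R (s :: x') (t :: y') → x = x' ∧ y = y'

/-- The syntactic right-complement `θ` is defined at `(s, t)` and at `(t, s)`, with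
`θ(s, t) = x` and `θ(t, s) = y`: either `s = t` and `x = y = ε`, or `s ≠ t` and `s x = t y` is
a relation of `R`. -/
def Complement (R : Relations S) (s t : S) (x y : List S) : Prop :=
  (s = t ∧ x = [] ∧ y = []) ∨ (s ≠ t ∧ IsRelation R (s :: x) (t :: y))

/-- `θ(s, t)` is defined. -/
def ComplementDefined (R : Relations S) (s t : S) : Prop := ∃ x y, Complement R s t x y

/-- One step of right-reversing: a factor `s⁻¹ t` is replaced by `θ(s, t) θ(t, s)⁻¹`. -/
def Step (R : Relations S) (w w' : SignedWord S) : Prop :=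
  ∃ (p q : SignedWord S) (s t : S) (x y : List S), Complement R s t x y ∧
    w = p ++ frac [s] [t] ++ q ∧ w' = p ++ (pos x ++ neg y) ++ q

/-- `w` is right-reversible to `w'`, in any number of steps. -/
def Reverses (R : Relations S) : SignedWord S → SignedWord S → Prop :=
  Relation.ReflTransGen (Step R)

/-- `w` is right-reversible to `w'` in at least one step. -/
def ReversesStrictly (R : Relations S) : SignedWord S → SignedWord S → Prop :=
  Relation.TransGen (Step R)

/-- `(u', v')` is a reduction factor of `(u, v)`. -/
def ReductionFactor (R : Relations S) (u v u' v' : List S) : Prop :=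
  ∃ p q : SignedWord S, Reverses R (frac u v) (p ++ frac u' v' ++ q)

/-- `(u', v')` is a strict reduction factor of `(u, v)`. -/
def StrictReductionFactor (R : Relations S) (u v u' v' : List S) : Prop :=
  ∃ p q : SignedWord S, ReversesStrictly R (frac u v) (p ++ frac u' v' ++ q)

/-- The pair `(u, v)` is periodic. -/
def Periodic (R : Relations S) (u v : List S) : Prop := StrictReductionFactor R u v u v

/-- The pair `(u, v)` is eventually periodic. -/
def EventuallyPeriodic (R : Relations S) (u v : List S) : Prop :=
  ∃ u' v' : List S, Periodic R u' v' ∧ ReductionFactor R u v u' v'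

/-- The pair `(u, v)` is failing. -/
def Failing (R : Relations S) (u v : List S) : Prop :=
  ∃ s t : S, ReductionFactor R u v [s] [t] ∧ ¬ ComplementDefined R s t

/-- Right-reversing of `u⁻¹ v` succeeds: it leads to a positive-negative word `v' u'⁻¹`. -/
def Succeeds (R : Relations S) (u v : List S) : Prop :=
  ∃ u' v' : List S, Reverses R (frac u v) (pos v' ++ neg u')

/-- The monoid presented by `(S, R)`. -/
abbrev PMonoid (R : Relations S) : Type _ :=
  PresentedMonoid fun a b : FreeMonoid S => (FreeMonoid.toList a, FreeMonoid.toList b) ∈ R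

/-- The element of the presented monoid represented by a word. -/
def val (R : Relations S) (w : List S) : PMonoid R :=
  PresentedMonoid.mk _ (FreeMonoid.ofList w)

/-- Right-reversing is complete for `(S, R)`: whenever `u v₁` and `v u₁` represent the same
element, there are words `u'`, `v'`, `w'` such that `u⁻¹ v` is right-reversible to `v' u'⁻¹`,
`u₁` represents the same element as `u' w'`, and `v₁` the same element as `v' w'`. -/
def IsReversingComplete (R : Relations S) : Prop :=
  ∀ u v u₁ v₁ : List S, val R (u ++ v₁) = val R (v ++ u₁) →
    ∃ u' v' w' : List S, Reverses R (frac u v) (pos v' ++ neg u') ∧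
      val R u₁ = val R (u' ++ w') ∧ val R v₁ = val R (v' ++ w')

end Words

section Monoids

variable {M : Type*} [Monoid M]

/-- `a` is a proper factor of `b`: `b = c a d` where `c` or `d` is not invertible. -/
def ProperFactor (a b : M) : Prop := ∃ c d : M, c * a * d = b ∧ (¬ IsUnit c ∨ ¬ IsUnit d)

/-- A monoid is noetherian if its proper factor relation is well-founded. -/
def IsNoetherianMonoid (M : Type*) [Monoid M] : Prop :=
  WellFounded (ProperFactor : M → M → Prop)

/-- `m` is a right-lcm of `a` and `b`. In any monoid `a ∣ m` says that `m = a * c` for some `c`,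
that is, that `m` is a right-multiple of `a`. -/
def IsRightLcm (a b m : M) : Prop := a ∣ m ∧ b ∣ m ∧ ∀ d : M, a ∣ d → b ∣ d → m ∣ d

/-- The elements `g * e` with `g ∈ G` and `e` invertible, and the invertible elements. -/
def sharp (G : Set M) : Set M := {x | IsUnit x ∨ ∃ g ∈ G, ∃ e : M, IsUnit e ∧ x = g * e}

/-- The path `a | b` is `G`-greedy. -/
def Greedy (G : Set M) (a b : M) : Prop := ∀ g ∈ G, ∀ f : M, g ∣ f * a * b → g ∣ f * a

/-- `G` is a Garside family (in a left-cancellative monoid): every element has a `G`-normal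
decomposition, that is, it is the product of a finite sequence of elements of `sharp G` in which
any two consecutive entries form a `G`-greedy path. -/
def IsGarsideFamily (G : Set M) : Prop :=
  ∀ a : M, ∃ l : List M, l.prod = a ∧ (∀ x ∈ l, x ∈ sharp G) ∧ l.IsChain (Greedy G)

end Monoids

section Runs

variable {S : Type*}

/-- A right-reversing run that starts with `u⁻¹ v` and ends with `w`: the list of the
successive signed words. -/
def IsRun (R : Relations S) (u v : List S) (r : List (SignedWord S)) (w : SignedWord S) : Prop :=
  r.head? = some (frac u v) ∧ r.IsChain (Step R) ∧ r.getLast? = some w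

/-- The signed word `w` shows a failure: it has a factor `s⁻¹ t` with `θ(s, t)` undefined. -/
def ShowsFailure (R : Relations S) (w : SignedWord S) : Prop :=
  ∃ (s t : S) (p q : SignedWord S), w = p ++ frac [s] [t] ++ q ∧ ¬ ComplementDefined R s t

/-- A run `r` with last word `w` shows eventual periodicity: some factor `u₁⁻¹ v₁` of a word of
the run has been reversed, in at least one step, to a signed word that has `u₁⁻¹ v₁` as a factor
again. -/
def ShowsPeriod (R : Relations S) (r : List (SignedWord S)) (w : SignedWord S) : Prop :=
  ∃ (u₁ v₁ : List S) (p q x y : SignedWord S),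
    p ++ frac u₁ v₁ ++ q ∈ r ∧ w = p ++ (x ++ frac u₁ v₁ ++ y) ++ q ∧
    ReversesStrictly R (frac u₁ v₁) (x ++ frac u₁ v₁ ++ y)

/-- An input of an algorithm: a finite list of relations and two words, with letters named by
natural numbers. -/
abbrev Input : Type := Relations ℕ × List ℕ × List ℕ

/-- An output of an algorithm: a list of signed words (a run), and either `some w`, where `w` is
a word, or `none` (no common right-multiple). -/
abbrev Output : Type := List (SignedWord ℕ) × Option (List ℕ)

/-- The input given by a presentation and two words, once the letters are named. -/
def input (name : S → ℕ) (R : Relations S) (u v : List S) : Input :=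
  (R.map fun r => (r.1.map name, r.2.map name), u.map name, v.map name)

/-- The named form of a list of signed words. -/
def nameRun (name : S → ℕ) (r : List (SignedWord S)) : List (SignedWord ℕ) :=
  r.map fun w => w.map fun a => (name a.1, a.2)

/-- The output `o` results from running right-reversing on `u⁻¹ v`: it records a run, which has
been stopped either at a positive-negative word `v' u'⁻¹`, with answer the word `u v'`, or at a
point where failure or eventual periodicity shows, with answer `none`. -/
def IsReversingOutput (name : S → ℕ) (R : Relations S) (u v : List S) (o : Output) : Prop :=
  ∃ (r : List (SignedWord S)) (w : SignedWord S), o.1 = nameRun name r ∧ IsRun R u v r w ∧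
    ((∃ u' v' : List S, w = pos v' ++ neg u' ∧ o.2 = some ((u ++ v').map name)) ∨
      ((ShowsFailure R w ∨ ShowsPeriod R r w) ∧ o.2 = none))

/-- The answer in `o` is correct: it is a word that represents a right-lcm of the elements
represented by `u` and `v`, or it is `none` and these have no common right-multiple. -/
def IsCorrectOutput (name : S → ℕ) (R : Relations S) (u v : List S) (o : Output) : Prop :=
  (∃ w : List S, o.2 = some (w.map name) ∧ IsRightLcm (val R u) (val R v) (val R w)) ∨
    (o.2 = none ∧ ¬ ∃ m : PMonoid R, val R u ∣ m ∧ val R v ∣ m)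

end Runs

end RightReversing

open RightReversing

/-! The algorithm is an unbounded search. It enumerates finite certificates, each recording a
reversing sequence with evidence of success, failure or periodicity, and returns the output of the
first valid one. Validity is primitive recursive (`primrecPred_valid`), so the search is partial
recursive and halts exactly when some output exists. An injective naming of the letters transports
outputs both ways (`isReversingOutput_nameRelations`).

Correctness rests on strong confluence (`Step.diamond`): if u⁻¹v reverses to a positive-negative
word, every reversing sequence from u⁻¹v extends to that word with the same total length, so neither
failure nor a period can occur. Completeness makes u⁻¹v succeed as soon as a common right-multiple
exists, and the final word then gives a right-lcm; conversely, success produces a common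
right-multiple.

For termination, consider the positive words left by reversing some z⁻¹t with t a letter
(`remainders`). They represent right-complements of letters. Greediness confines the
right-complements of a member of a Garside family G to G ∪ {1}; pasting lcms extends finiteness to
all elements, and noetherianity leaves finitely many words per element (`finite_remainders`). A pair
that does not succeed leads to a non-succeeding pair (letter, remainder), and such a pair, unless
failing, leads to another one in at least one step. As there are finitely many of them, one recurs
and is periodic (`failing_or_eventuallyPeriodic_or_succeeds`). -/

namespace RightReversing

/-! ### Confluence of right-reversing. -/

section Combinatorics

variable {S : Type*} {R : Relations S}

@[simp] lemma pos_nil : pos ([] : List S) = [] := rfl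

@[simp] lemma pos_cons (s : S) (u : List S) : pos (s :: u) = (s, true) :: pos u := rfl

@[simp] lemma pos_append (u v : List S) : pos (u ++ v) = pos u ++ pos v := by simp [pos]

@[simp] lemma neg_nil : neg ([] : List S) = [] := rfl

@[simp] lemma neg_cons (s : S) (u : List S) : neg (s :: u) = neg u ++ [(s, false)] := by
  simp [neg]

@[simp] lemma neg_append (u v : List S) : neg (u ++ v) = neg v ++ neg u := by simp [neg]

lemma frac_singleton (s t : S) : frac [s] [t] = [(s, false), (t, true)] := rfl

lemma Step.context {w w' : SignedWord S} (h : Step R w w') (a b : SignedWord S) :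
    Step R (a ++ w ++ b) (a ++ w' ++ b) := by
  obtain ⟨p, q, s, t, x, y, hc, rfl, rfl⟩ := h
  exact ⟨a ++ p, q ++ b, s, t, x, y, hc, by simp, by simp⟩

lemma Reverses.refl (w : SignedWord S) : Reverses R w w := Relation.ReflTransGen.refl

lemma Reverses.trans {w w' w'' : SignedWord S} (h : Reverses R w w') (h' : Reverses R w' w'') :
    Reverses R w w'' :=
  Relation.ReflTransGen.trans h h'

lemma Step.reversesStrictly {w w' : SignedWord S} (h : Step R w w') : ReversesStrictly R w w' :=
  Relation.TransGen.single h

lemma Reverses.context {w w' : SignedWord S} (h : Reverses R w w') (a b : SignedWord S) :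
    Reverses R (a ++ w ++ b) (a ++ w' ++ b) :=
  Relation.ReflTransGen.lift (fun w => a ++ w ++ b) (fun _ _ h => Step.context h a b) _ _ h

lemma ReversesStrictly.context {w w' : SignedWord S} (h : ReversesStrictly R w w')
    (a b : SignedWord S) : ReversesStrictly R (a ++ w ++ b) (a ++ w' ++ b) :=
  Relation.TransGen.lift (fun w => a ++ w ++ b) (fun _ _ h => Step.context h a b) _ _ h

lemma ReductionFactor.trans {u v u' v' u'' v'' : List S} (h : ReductionFactor R u v u' v')
    (h' : ReductionFactor R u' v' u'' v'') : ReductionFactor R u v u'' v'' := by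
  obtain ⟨p, q, h⟩ := h
  obtain ⟨p', q', h'⟩ := h'
  have h' : Reverses R (p ++ frac u' v' ++ q) (p ++ p' ++ frac u'' v'' ++ (q' ++ q)) := by
    simpa using h'.context p q
  exact ⟨p ++ p', q' ++ q, h.trans h'⟩

lemma StrictReductionFactor.reductionFactor {u v u' v' : List S}
    (h : StrictReductionFactor R u v u' v') : ReductionFactor R u v u' v' := by
  obtain ⟨p, q, h⟩ := h
  exact ⟨p, q, h.to_reflTransGen⟩

lemma StrictReductionFactor.trans_reductionFactor {u v u' v' u'' v'' : List S}
    (h : StrictReductionFactor R u v u' v') (h' : ReductionFactor R u' v' u'' v'') :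
    StrictReductionFactor R u v u'' v'' := by
  obtain ⟨p, q, h⟩ := h
  obtain ⟨p', q', h'⟩ := h'
  have h' : Reverses R (p ++ frac u' v' ++ q) (p ++ p' ++ frac u'' v'' ++ (q' ++ q)) := by
    simpa using h'.context p q
  exact ⟨p ++ p', q' ++ q, Relation.TransGen.trans_left h h'⟩

lemma StrictReductionFactor.trans {u v u' v' u'' v'' : List S}
    (h : StrictReductionFactor R u v u' v') (h' : StrictReductionFactor R u' v' u'' v'') :
    StrictReductionFactor R u v u'' v'' :=
  h.trans_reductionFactor h'.reductionFactor

lemma Failing.of_reductionFactor {u v u' v' : List S} (h : ReductionFactor R u v u' v')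
    (h' : Failing R u' v') : Failing R u v := by
  obtain ⟨s, t, hst, hd⟩ := h'
  exact ⟨s, t, h.trans hst, hd⟩

lemma Complement.symm {s t : S} {x y : List S} (h : Complement R s t x y) :
    Complement R t s y x := by
  rcases h with ⟨rfl, rfl, rfl⟩ | ⟨hne, h⟩
  · exact Or.inl ⟨rfl, rfl, rfl⟩
  · exact Or.inr ⟨hne.symm, h.symm⟩

lemma Complement.unique (hR : IsRightComplemented R) {s t : S} {x y x' y' : List S}
    (h : Complement R s t x y) (h' : Complement R s t x' y') : x = x' ∧ y = y' := by
  rcases h with ⟨rfl, rfl, rfl⟩ | ⟨hne, h⟩ <;> rcases h' with ⟨h1, rfl, rfl⟩ | ⟨hne', h'⟩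
  · exact ⟨rfl, rfl⟩
  · exact absurd rfl hne'
  · exact absurd h1 hne
  · exact hR.unique s t x y x' y' hne h h'

/-- Two factors of length two of the form `s⁻¹ t` of a signed word coincide or are disjoint. -/
lemma factor_overlap {p q p' q' : SignedWord S} {s t s' t' : S}
    (h : p ++ frac [s] [t] ++ q = p' ++ frac [s'] [t'] ++ q') :
    (p = p' ∧ s = s' ∧ t = t' ∧ q = q') ∨
      (∃ r, p' = p ++ frac [s] [t] ++ r ∧ q = r ++ frac [s'] [t'] ++ q') ∨
      (∃ r, p = p' ++ frac [s'] [t'] ++ r ∧ q' = r ++ frac [s] [t] ++ q) := by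
  induction p generalizing p' with
  | nil =>
    match p' with
    | [] => simp [frac_singleton] at h; grind
    | [a] => simp [frac_singleton] at h
    | a :: b :: r => simp [frac_singleton] at h ⊢; grind
  | cons c p ih =>
    match p' with
    | [] =>
      match p with
      | [] => simp [frac_singleton] at h
      | d :: r => simp [frac_singleton] at h ⊢; grind
    | a :: p' =>
      simp only [List.cons_append, List.cons.injEq] at h
      obtain ⟨rfl, h⟩ := h
      rcases ih h with h | ⟨r, h⟩ | ⟨r, h⟩
      · left; simpa using h
      · right; left; exact ⟨r, by simpa using h⟩
      · right; right; exact ⟨r, by simpa using h⟩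

lemma pos_append_neg_ne (u v : List S) (p q : SignedWord S) (s t : S) :
    pos v ++ neg u ≠ p ++ frac [s] [t] ++ q := by
  intro h
  -- In a positive-negative word no negative letter precedes a positive one, whereas s⁻¹t has
  -- exactly this pattern.
  have h1 : (pos v ++ neg u).Pairwise fun a b => a.2 = true ∨ b.2 = false := by
    rw [List.pairwise_append]
    refine ⟨?_, ?_, ?_⟩
    · exact List.pairwise_of_forall_mem_list (by simp [pos])
    · exact List.pairwise_of_forall_mem_list (by simp [neg])
    · simp [pos]
  rw [h] at h1
  simp [List.pairwise_append, frac_singleton] at h1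

lemma not_step_pos_append_neg (u v : List S) (w : SignedWord S) :
    ¬ Step R (pos v ++ neg u) w := by
  rintro ⟨p, q, s, t, x, y, -, h, -⟩
  exact pos_append_neg_ne _ _ _ _ _ _ h

lemma not_showsFailure_pos_append_neg (u v : List S) : ¬ ShowsFailure R (pos v ++ neg u) := by
  rintro ⟨s, t, p, q, h, -⟩
  exact pos_append_neg_ne _ _ _ _ _ _ h

lemma pos_append_neg_inj {u v u' v' : List S} (h : pos v ++ neg u = pos v' ++ neg u') :
    v = v' ∧ u = u' := by
  have h1 : (pos v ++ neg u).filter (·.2) = pos v := by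
    simp [pos, neg, List.filter_append, List.filter_map, List.filter_reverse, Function.comp_def]
  have h2 : (pos v' ++ neg u').filter (·.2) = pos v' := by
    simp [pos, neg, List.filter_append, List.filter_map, List.filter_reverse, Function.comp_def]
  have h3 : pos v = pos v' := by rw [← h1, ← h2, h]
  have h4 : neg u = neg u' := by rw [h3] at h; exact List.append_cancel_left h
  have hf : Function.Injective fun s : S => (s, true) := fun a b h => (Prod.mk.inj h).1
  have hg : Function.Injective fun s : S => (s, false) := fun a b h => (Prod.mk.inj h).1
  exact ⟨hf.list_map h3, hg.list_map (List.reverse_injective h4)⟩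

/-- Steps at the same factor agree because θ is single-valued; steps at disjoint factors commute.
Closing the diamond with exactly one step on each side is what makes lengths invariant below. -/
lemma Step.diamond (hR : IsRightComplemented R) {w a b : SignedWord S} (ha : Step R w a)
    (hb : Step R w b) : a = b ∨ ∃ c, Step R a c ∧ Step R b c := by
  obtain ⟨p, q, s, t, x, y, hc, rfl, rfl⟩ := ha
  obtain ⟨p', q', s', t', x', y', hc', h, rfl⟩ := hb
  rcases factor_overlap h with ⟨rfl, rfl, rfl, rfl⟩ | ⟨r, rfl, rfl⟩ | ⟨r, rfl, rfl⟩
  · obtain ⟨rfl, rfl⟩ := hc.unique hR hc'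
    exact Or.inl rfl
  · exact Or.inr ⟨p ++ (pos x ++ neg y) ++ r ++ (pos x' ++ neg y') ++ q',
      ⟨p ++ (pos x ++ neg y) ++ r, q', s', t', x', y', hc', by simp, by simp⟩,
      ⟨p, r ++ (pos x' ++ neg y') ++ q', s, t, x, y, hc, by simp, by simp⟩⟩
  · exact Or.inr ⟨p' ++ (pos x' ++ neg y') ++ r ++ (pos x ++ neg y) ++ q,
      ⟨p', r ++ (pos x ++ neg y) ++ q, s', t', x', y', hc', by simp, by simp⟩,
      ⟨p' ++ (pos x' ++ neg y') ++ r, q, s, t, x, y, hc, by simp, by simp⟩⟩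

/-- A blocked factor s⁻¹t is disjoint from every reversible factor, so it survives all steps. -/
lemma ShowsFailure.step {w a : SignedWord S} (hw : ShowsFailure R w) (ha : Step R w a) :
    ShowsFailure R a := by
  obtain ⟨s, t, p, q, rfl, hd⟩ := hw
  obtain ⟨p', q', s', t', x, y, hc, h, rfl⟩ := ha
  rcases factor_overlap h with ⟨rfl, rfl, rfl, rfl⟩ | ⟨r, rfl, rfl⟩ | ⟨r, rfl, rfl⟩
  · exact absurd ⟨x, y, hc⟩ hd
  · exact ⟨s, t, p, r ++ (pos x ++ neg y) ++ q', by simp, hd⟩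
  · exact ⟨s, t, p' ++ (pos x ++ neg y) ++ r, q, by simp, hd⟩

/-- `w` is right-reversible to `z` in exactly `n` steps. -/
def ReversesIn (R : Relations S) (z : SignedWord S) : ℕ → SignedWord S → Prop
  | 0, w => w = z
  | n + 1, w => ∃ a, Step R w a ∧ ReversesIn R z n a

lemma Reverses.exists_reversesIn {w z : SignedWord S} (h : Reverses R w z) :
    ∃ n, ReversesIn R z n w := by
  induction h using Relation.ReflTransGen.head_induction_on with
  | refl => exact ⟨0, rfl⟩
  | head h _ ih =>
    obtain ⟨n, hn⟩ := ih
    exact ⟨n + 1, _, h, hn⟩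

/-- By the diamond, any step brings a word exactly one step closer to the irreducible word `z`,
whichever factor is reversed. -/
lemma ReversesIn.of_step (hR : IsRightComplemented R) {z : SignedWord S}
    (hz : ∀ a, ¬ Step R z a) {n : ℕ} {w a : SignedWord S} (hw : ReversesIn R z n w)
    (ha : Step R w a) : ∃ m, n = m + 1 ∧ ReversesIn R z m a := by
  induction n generalizing w a with
  | zero => exact absurd (hw ▸ ha) (hz a)
  | succ n ih =>
    obtain ⟨b, hb, hn⟩ := hw
    refine ⟨n, rfl, ?_⟩
    rcases ha.diamond hR hb with rfl | ⟨c, hac, hbc⟩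
    · exact hn
    · obtain ⟨m, rfl, hm⟩ := ih hn hbc
      exact ⟨c, hac, hm⟩

lemma ReversesIn.acc (hR : IsRightComplemented R) {z : SignedWord S}
    (hz : ∀ a, ¬ Step R z a) {n : ℕ} {w : SignedWord S} (hw : ReversesIn R z n w) :
    Acc (flip (Step R)) w := by
  induction n generalizing w with
  | zero => exact ⟨_, fun a ha => absurd (hw ▸ ha : Step R z a) (hz a)⟩
  | succ n ih =>
    refine ⟨_, fun a ha => ?_⟩
    obtain ⟨m, hm, h⟩ := hw.of_step hR hz ha
    obtain rfl : n = m := by omega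
    exact ih h

lemma ReversesIn.of_reverses (hR : IsRightComplemented R) {z : SignedWord S}
    (hz : ∀ a, ¬ Step R z a) {n : ℕ} {w a : SignedWord S} (hw : ReversesIn R z n w)
    (ha : Reverses R w a) : ∃ m, ReversesIn R z m a := by
  induction ha with
  | refl => exact ⟨n, hw⟩
  | tail _ h ih =>
    obtain ⟨m, hm⟩ := ih
    obtain ⟨k, -, hk⟩ := hm.of_step hR hz h
    exact ⟨k, hk⟩

lemma ReversesIn.not_showsFailure {u v : List S} {n : ℕ} {w : SignedWord S}
    (hw : ReversesIn R (pos v ++ neg u) n w) :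
    ¬ ShowsFailure R w := by
  intro hf
  induction n generalizing w with
  | zero => exact not_showsFailure_pos_append_neg u v (hw ▸ hf)
  | succ n ih =>
    obtain ⟨a, ha, hn⟩ := hw
    exact ih hn (hf.step ha)

lemma Reverses.pos_append_neg_unique (hR : IsRightComplemented R) {w : SignedWord S}
    {u v u' v' : List S} (h : Reverses R w (pos v ++ neg u))
    (h' : Reverses R w (pos v' ++ neg u')) : v = v' ∧ u = u' := by
  obtain ⟨n, hn⟩ := h.exists_reversesIn
  obtain ⟨m, hm⟩ := hn.of_reverses hR (not_step_pos_append_neg u v) h'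
  cases m with
  | zero => exact (pos_append_neg_inj hm).imp Eq.symm Eq.symm
  | succ m =>
    obtain ⟨a, ha, -⟩ := hm
    exact absurd ha (not_step_pos_append_neg _ _ _)

lemma Succeeds.not_showsFailure (hR : IsRightComplemented R) {u v : List S}
    (h : Succeeds R u v) {w : SignedWord S} (hw : Reverses R (frac u v) w) :
    ¬ ShowsFailure R w := by
  obtain ⟨u', v', h⟩ := h
  obtain ⟨n, hn⟩ := h.exists_reversesIn
  obtain ⟨m, hm⟩ := hn.of_reverses hR (not_step_pos_append_neg _ _) hw
  exact hm.not_showsFailure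

/-- A factor that reproduces itself can be reversed again forever, inside ever larger contexts;
hence the induction with `p` and `q` free. -/
lemma not_acc_of_reversesStrictly {w x y : SignedWord S}
    (h : ReversesStrictly R w (x ++ w ++ y)) (p q : SignedWord S) :
    ¬ Acc (flip (Step R)) (p ++ w ++ q) := by
  intro hacc
  replace hacc := hacc.transGen
  generalize hz : p ++ w ++ q = z at hacc
  induction hacc generalizing p q with
  | intro z _ ih =>
    refine ih (p ++ (x ++ w ++ y) ++ q) ?_ (p ++ x) (y ++ q) (by simp)
    have : ReversesStrictly R z (p ++ (x ++ w ++ y) ++ q) := hz ▸ h.context p q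
    exact Relation.transGen_swap.2 this

lemma Succeeds.not_periodic (hR : IsRightComplemented R) {u v : List S}
    (h : Succeeds R u v) {w p q x y : SignedWord S} (hw : Reverses R (frac u v) (p ++ w ++ q)) :
    ¬ ReversesStrictly R w (x ++ w ++ y) := by
  obtain ⟨u', v', h⟩ := h
  obtain ⟨n, hn⟩ := h.exists_reversesIn
  obtain ⟨m, hm⟩ := hn.of_reverses hR (not_step_pos_append_neg _ _) hw
  exact fun hs => not_acc_of_reversesStrictly hs p q (hm.acc hR (not_step_pos_append_neg _ _))

/-! ### Runs and outputs. -/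

lemma isRun_singleton (u v : List S) : IsRun R u v [frac u v] (frac u v) := by
  simp [IsRun]

lemma IsRun.step {u v : List S} {r : List (SignedWord S)} {w w' : SignedWord S}
    (h : IsRun R u v r w) (h' : Step R w w') : IsRun R u v (r ++ [w']) w' := by
  obtain ⟨h1, h2, h3⟩ := h
  refine ⟨by simp [h1], ?_, by simp⟩
  rw [List.isChain_append]
  refine ⟨h2, by simp, ?_⟩
  simp [h3, h']

lemma IsRun.mem {u v : List S} {r : List (SignedWord S)} {w : SignedWord S}
    (h : IsRun R u v r w) : w ∈ r := List.mem_of_getLast? h.2.2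

lemma IsRun.exists_of_reverses {u v : List S} {r : List (SignedWord S)} {w w' : SignedWord S}
    (h : IsRun R u v r w) (h' : Reverses R w w') : ∃ r', IsRun R u v r' w' ∧ r ⊆ r' := by
  induction h' with
  | refl => exact ⟨r, h, List.Subset.refl r⟩
  | tail _ hs ih =>
    obtain ⟨r', h1, h2⟩ := ih
    exact ⟨_, h1.step hs, fun a ha => List.mem_append_left _ (h2 ha)⟩

lemma exists_isRun {u v : List S} {w : SignedWord S} (h : Reverses R (frac u v) w) :
    ∃ r, IsRun R u v r w := by
  obtain ⟨r, hr, -⟩ := (isRun_singleton u v).exists_of_reverses h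
  exact ⟨r, hr⟩

lemma reverses_of_isChain {r : List (SignedWord S)} {w w' : SignedWord S}
    (h : (w :: r).IsChain (Step R)) (h' : w' ∈ w :: r) : Reverses R w w' := by
  induction r generalizing w with
  | nil =>
    obtain rfl : w' = w := by simpa using h'
    exact Relation.ReflTransGen.refl
  | cons a r ih =>
    rw [List.isChain_cons_cons] at h
    rcases List.mem_cons.1 h' with rfl | h'
    · exact Relation.ReflTransGen.refl
    · exact Relation.ReflTransGen.head h.1 (ih h.2 h')

lemma IsRun.reverses {u v : List S} {r : List (SignedWord S)} {w w' : SignedWord S}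
    (h : IsRun R u v r w) (h' : w' ∈ r) : Reverses R (frac u v) w' := by
  obtain ⟨h1, h2, -⟩ := h
  cases r with
  | nil => simp at h1
  | cons a r =>
    obtain rfl : a = frac u v := by simpa using h1
    exact reverses_of_isChain h2 h'

lemma exists_isReversingOutput_iff (name : S → ℕ) (u v : List S) :
    (∃ o, IsReversingOutput name R u v o) ↔
      Failing R u v ∨ EventuallyPeriodic R u v ∨ Succeeds R u v := by
  constructor
  · rintro ⟨o, r, w, -, hr, ⟨u', v', rfl, -⟩ | ⟨⟨s, t, p, q, rfl, hd⟩ |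
      ⟨u₁, v₁, p, q, x, y, hm, rfl, hs⟩, -⟩⟩
    · exact Or.inr (Or.inr ⟨u', v', hr.reverses hr.mem⟩)
    · exact Or.inl ⟨s, t, ⟨p, q, hr.reverses hr.mem⟩, hd⟩
    · exact Or.inr (Or.inl ⟨u₁, v₁, ⟨x, y, hs⟩, p, q, hr.reverses hm⟩)
  · rintro (⟨s, t, ⟨p, q, h⟩, hd⟩ | ⟨u', v', ⟨x, y, hs⟩, p, q, h⟩ | ⟨u', v', h⟩)
    · obtain ⟨r, hr⟩ := exists_isRun h
      exact ⟨(_, _), r, _, rfl, hr, Or.inr ⟨Or.inl ⟨s, t, p, q, rfl, hd⟩, rfl⟩⟩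
    · obtain ⟨r, hr⟩ := exists_isRun h
      -- The run is prolonged by one period and still contains the first occurrence of the periodic
      -- factor.
      obtain ⟨r', hr', hsub⟩ := hr.exists_of_reverses (hs.context p q).to_reflTransGen
      exact ⟨(_, _), r', _, rfl, hr',
        Or.inr ⟨Or.inr ⟨u', v', p, q, x, y, hsub hr.mem, rfl, hs⟩, rfl⟩⟩
    · obtain ⟨r, hr⟩ := exists_isRun h
      exact ⟨(_, _), r, _, rfl, hr, Or.inl ⟨u', v', rfl, rfl⟩⟩

/-- A pair for which right-reversing succeeds has no output with answer `none`. -/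
lemma Succeeds.output_ne_none (hR : IsRightComplemented R) {name : S → ℕ} {u v : List S}
    (h : Succeeds R u v) {o : Output} (ho : IsReversingOutput name R u v o) :
    ∃ u' v' : List S, Reverses R (frac u v) (pos v' ++ neg u') ∧
      o.2 = some ((u ++ v').map name) := by
  obtain ⟨r, w, -, hr, ⟨u', v', rfl, ho⟩ | ⟨hf | ⟨u₁, v₁, p, q, x, y, hm, rfl, hs⟩, -⟩⟩ := ho
  · exact ⟨u', v', hr.reverses hr.mem, ho⟩
  · exact absurd hf (h.not_showsFailure hR (hr.reverses hr.mem))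
  · exact absurd hs (h.not_periodic hR (hr.reverses hm))

end Combinatorics

/-! ### Right-complements in a monoid with a finite Garside family. -/

section Monoids

variable {M : Type*} [Monoid M]

/-- The right-complements of `g`: the elements `c` such that `z c` is a right-lcm of `z` and `g`
for some `z`. -/
def complements (g : M) : Set M := {c | ∃ z, IsRightLcm z g (z * c)}

/-- Factors are removed from the right end: the induction hypothesis with `f * x` for `f` reduces
the product to two factors, where greediness applies. -/
lemma Greedy.dvd_of_isChain {G : Set M} {g : M} (hg : g ∈ G) {l : List M} {x f : M}
    (hl : (x :: l).IsChain (Greedy G)) (h : g ∣ f * x * l.prod) : g ∣ f * x := by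
  induction l generalizing x f with
  | nil => simpa using h
  | cons y l ih =>
    rw [List.isChain_cons_cons] at hl
    exact hl.1 g hg f (ih hl.2 (by simpa [mul_assoc] using h))

variable [IsLeftCancelMul M]

lemma complements_one (hunit : ∀ a b : M, a * b = 1 → a = 1) :
    complements (1 : M) ⊆ {1} := by
  rintro c ⟨z, -, -, h⟩
  obtain ⟨k, hk⟩ := h z dvd_rfl (one_dvd z)
  refine hunit c k (mul_left_cancel (a := z) ?_)
  rw [← mul_assoc, ← hk, mul_one]

/-- Write c = x₁⋯xₚ in normal form. Greediness reduces g ∣ z x₁⋯xₚ to g ∣ z x₁, so z x₁ is already a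
common multiple of z and g; minimality of the lcm forces x₂⋯xₚ = 1. -/
lemma complements_subset_of_isGarsideFamily (hunit : ∀ a b : M, a * b = 1 → a = 1) {G : Set M}
    (hG : IsGarsideFamily G) {g : M} (hg : g ∈ G) : complements g ⊆ insert 1 G := by
  rintro c ⟨z, -, h2, h3⟩
  obtain ⟨l, rfl, hl, hch⟩ := hG c
  cases l with
  | nil => simp
  | cons x l =>
    have hdvd : g ∣ z * x :=
      Greedy.dvd_of_isChain hg hch (by simpa [mul_assoc] using h2)
    obtain ⟨k, hk⟩ := h3 (z * x) (dvd_mul_right z x) hdvd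
    have hl1 : l.prod * k = 1 := by
      refine mul_left_cancel (a := x) (mul_left_cancel (a := z) ?_)
      simpa [mul_assoc] using hk.symm
    rw [List.prod_cons, hunit _ _ hl1, mul_one]
    rcases hl x (by simp) with hx | ⟨g', hg', e, he, rfl⟩
    · obtain ⟨b, hb⟩ := hx.exists_right_inv
      exact Or.inl (hunit x b hb)
    · obtain ⟨b, hb⟩ := he.exists_right_inv
      rw [hunit e b hb, mul_one]
      exact Or.inr hg'

/-- The lcm of z and ab is obtained by pasting the lcm z c₁ = a e of z and a with the lcm e d of e
and b, so that c = c₁ d. -/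
lemma complements_mul_subset
    (hlcm : ∀ a b d : M, a ∣ d → b ∣ d → ∃ m, IsRightLcm a b m) (a b : M) :
    complements (a * b) ⊆ Set.image2 (· * ·) (complements a) (complements b) := by
  rintro c ⟨z, h1, h2, h3⟩
  obtain ⟨m, ⟨c₁, rfl⟩, ⟨e, he⟩, hm⟩ := hlcm z a (z * c) h1 ((dvd_mul_right a b).trans h2)
  obtain ⟨d, hd⟩ := hm _ h1 ((dvd_mul_right a b).trans h2)
  have hzc : z * c = a * (e * d) := by rw [hd, he, mul_assoc]
  refine ⟨c₁, ⟨z, dvd_mul_right z c₁, ⟨e, he⟩, hm⟩, d, ⟨e, dvd_mul_right e d, ?_, ?_⟩, ?_⟩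
  · obtain ⟨k, hk⟩ := h2
    exact ⟨k, mul_left_cancel (a := a) (by rw [← hzc, hk, mul_assoc])⟩
  · rintro f ⟨k, rfl⟩ hb
    have hz : z ∣ a * (e * k) := ⟨c₁ * k, by rw [← mul_assoc, ← mul_assoc, he]⟩
    obtain ⟨j, hj⟩ := h3 _ hz (mul_dvd_mul_left a hb)
    exact ⟨j, mul_left_cancel (a := a) (by rw [hj, hzc, mul_assoc])⟩
  · exact mul_left_cancel (a := z) (by rw [hd, mul_assoc])

/-- In a monoid with a finite Garside family, any element has finitely many right-complements. -/
lemma finite_complements (hunit : ∀ a b : M, a * b = 1 → a = 1)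
    (hlcm : ∀ a b d : M, a ∣ d → b ∣ d → ∃ m, IsRightLcm a b m) {G : Set M} (hfin : G.Finite)
    (hG : IsGarsideFamily G) (a : M) : (complements a).Finite := by
  obtain ⟨l, rfl, hl, -⟩ := hG a
  -- Only the factorization into elements of `sharp G` matters from here on, not greediness.
  induction l with
  | nil => exact (Set.finite_singleton 1).subset (complements_one hunit)
  | cons x l ih =>
    rw [List.prod_cons]
    refine Set.Finite.subset (Set.Finite.image2 _ ?_ (ih fun y hy => hl y (by simp [hy])))
      (complements_mul_subset hlcm x l.prod)
    rcases hl x (by simp) with hx | ⟨g, hg, e, he, rfl⟩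
    · obtain ⟨b, hb⟩ := hx.exists_right_inv
      rw [hunit x b hb]
      exact (Set.finite_singleton 1).subset (complements_one hunit)
    · obtain ⟨b, hb⟩ := he.exists_right_inv
      rw [hunit e b hb, mul_one]
      exact (hfin.insert 1).subset (complements_subset_of_isGarsideFamily hunit hG hg)

end Monoids

/-! ### Right-reversing and divisibility in the presented monoid. -/

section Presented

variable {S : Type*} {R : Relations S}

@[simp] lemma val_nil : val R [] = 1 := map_one (PresentedMonoid.mk _)

@[simp] lemma val_append (u v : List S) : val R (u ++ v) = val R u * val R v :=
  map_mul (PresentedMonoid.mk _) (FreeMonoid.ofList u) (FreeMonoid.ofList v)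

lemma val_cons (s : S) (u : List S) : val R (s :: u) = val R [s] * val R u :=
  val_append [s] u

lemma val_surjective : Function.Surjective (val R) := fun a => by
  obtain ⟨w, rfl⟩ := PresentedMonoid.surjective_mk a
  exact ⟨FreeMonoid.toList w, rfl⟩

lemma IsRelation.val_eq {w w' : List S} (h : IsRelation R w w') : val R w = val R w' := by
  rcases h with h | h
  · exact PresentedMonoid.mk_eq_mk_of_rel h
  · exact (PresentedMonoid.mk_eq_mk_of_rel (rels := fun a b : FreeMonoid S =>
      (FreeMonoid.toList a, FreeMonoid.toList b) ∈ R) h).symm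

lemma Complement.val_eq {s t : S} {x y : List S} (h : Complement R s t x y) :
    val R [s] * val R x = val R [t] * val R y := by
  rcases h with ⟨rfl, rfl, rfl⟩ | ⟨-, h⟩
  · rfl
  · rw [← val_cons, ← val_cons, h.val_eq]

/-- Send every letter to 0 in the multiplicative monoid ℕ. No relation equates ε with a nonempty
word, so this respects the relations, and it separates ε (value 1) from nonempty words (value 0). -/
lemma eq_nil_of_val_eq_one (hR : IsRightComplemented R) {w : List S} (h : val R w = 1) :
    w = [] := by
  have hlift : ∀ l : List S,
      FreeMonoid.lift (fun _ : S => (0 : ℕ)) (FreeMonoid.ofList l) = 1 ↔ l = [] := by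
    intro l
    cases l with
    | nil => simp
    | cons s l => simp [FreeMonoid.lift_apply]
  have hzero : ∀ l : List S, l ≠ [] →
      FreeMonoid.lift (fun _ : S => (0 : ℕ)) (FreeMonoid.ofList l) = 0 := by
    intro l hl
    cases l with
    | nil => exact absurd rfl hl
    | cons s l => simp [FreeMonoid.lift_apply]
  have hrel : ∀ a b : FreeMonoid S, (FreeMonoid.toList a, FreeMonoid.toList b) ∈ R →
      FreeMonoid.lift (fun _ : S => (0 : ℕ)) a = FreeMonoid.lift (fun _ : S => (0 : ℕ)) b := by
    intro a b hab
    change FreeMonoid.lift (fun _ : S => (0 : ℕ)) (FreeMonoid.ofList (FreeMonoid.toList a)) =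
      FreeMonoid.lift (fun _ : S => (0 : ℕ)) (FreeMonoid.ofList (FreeMonoid.toList b))
    generalize FreeMonoid.toList a = u at hab
    generalize FreeMonoid.toList b = v at hab
    by_cases hu : u = [] <;> by_cases hv : v = []
    · rw [hu, hv]
    · exact absurd (hR.no_eps v (Or.inr (hu ▸ hab))) hv
    · exact absurd (hR.no_eps u (Or.inl (hv ▸ hab))) hu
    · rw [hzero u hu, hzero v hv]
  have h1 := congrArg (PresentedMonoid.lift _ hrel) h
  rw [map_one] at h1
  exact (hlift w).1 h1

lemma eq_one_of_mul_eq_one (hR : IsRightComplemented R) (a b : PMonoid R) (h : a * b = 1) :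
    a = 1 := by
  obtain ⟨u, rfl⟩ := val_surjective a
  obtain ⟨v, rfl⟩ := val_surjective b
  rw [← val_append] at h
  rw [(List.append_eq_nil_iff.1 (eq_nil_of_val_eq_one hR h)).1, val_nil]

lemma not_isUnit_val_singleton (hR : IsRightComplemented R) (s : S) : ¬ IsUnit (val R [s]) := by
  intro h
  obtain ⟨b, hb⟩ := h.exists_right_inv
  exact List.cons_ne_nil s [] (eq_nil_of_val_eq_one hR (eq_one_of_mul_eq_one hR _ _ hb))

/-- The pairs of elements that are related by reading a signed word, where a positive letter
multiplies on the right and a negative letter divides on the right. -/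
def Reads (R : Relations S) : SignedWord S → PMonoid R → PMonoid R → Prop
  | [], a, b => a = b
  | (s, true) :: w, a, b => Reads R w (a * val R [s]) b
  | (s, false) :: w, a, b => ∃ c, a = c * val R [s] ∧ Reads R w c b

lemma reads_append (w w' : SignedWord S) (a b : PMonoid R) :
    Reads R (w ++ w') a b ↔ ∃ c, Reads R w a c ∧ Reads R w' c b := by
  induction w generalizing a with
  | nil => simp [Reads]
  | cons x w ih =>
    obtain ⟨s, _ | _⟩ := x
    · simp only [List.cons_append, Reads, ih]
      grind
    · simp only [List.cons_append, Reads, ih]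

lemma reads_pos (w : List S) (a b : PMonoid R) : Reads R (pos w) a b ↔ a * val R w = b := by
  induction w generalizing a with
  | nil => simp [Reads]
  | cons s w ih => rw [pos_cons, Reads, ih, val_cons s w, mul_assoc]

lemma reads_neg (w : List S) (a b : PMonoid R) : Reads R (neg w) a b ↔ a = b * val R w := by
  induction w generalizing b with
  | nil => simp [Reads]
  | cons s w ih =>
    rw [neg_cons, reads_append]
    simp only [ih, Reads]
    rw [val_cons s w, ← mul_assoc]
    grind

/-- A signed word has no value in a monoid, so it is read as a relation, which a reversing step can
only enlarge: from d = e s and c = e t one gets d θ(s,t) = c θ(t,s). -/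
lemma Step.reads {w w' : SignedWord S} (h : Step R w w') {a b : PMonoid R}
    (hab : Reads R w a b) : Reads R w' a b := by
  obtain ⟨p, q, s, t, x, y, hc, rfl, rfl⟩ := h
  simp only [reads_append, frac, reads_pos, reads_neg] at hab ⊢
  obtain ⟨c, ⟨d, hd, e, rfl, rfl⟩, hq⟩ := hab
  exact ⟨_, ⟨_, hd, _, rfl, by rw [mul_assoc, mul_assoc, hc.val_eq]⟩, hq⟩

lemma Reverses.reads {w w' : SignedWord S} (h : Reverses R w w') {a b : PMonoid R}
    (hab : Reads R w a b) : Reads R w' a b := by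
  induction h with
  | refl => exact hab
  | tail _ hs ih => exact hs.reads ih

/-- Right-reversing computes common right-multiples. -/
lemma Reverses.val_eq {u v u' v' : List S} (h : Reverses R (frac u v) (pos v' ++ neg u')) :
    val R u * val R v' = val R v * val R u' := by
  -- Reading u⁻¹v from u passes through 1 and ends at v.
  have h1 : Reads R (frac u v) (val R u) (val R v) := by
    simp [frac, reads_append, reads_pos, reads_neg]
    exact ⟨1, by simp, by simp⟩
  simpa [reads_append, reads_pos, reads_neg] using h.reads h1

lemma succeeds_of_dvd (hC : IsReversingComplete R) {u v : List S} {d : PMonoid R}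
    (hu : val R u ∣ d) (hv : val R v ∣ d) : Succeeds R u v := by
  obtain ⟨a, rfl⟩ := hu
  obtain ⟨b, hb⟩ := hv
  obtain ⟨v₁, rfl⟩ := val_surjective a
  obtain ⟨u₁, rfl⟩ := val_surjective b
  obtain ⟨u', v', -, h, -⟩ := hC u v u₁ v₁ (by simpa using hb)
  exact ⟨u', v', h⟩

/-- Completeness supplies some terminal word through which a given common multiple factors;
uniqueness of terminal words identifies it with the given one. -/
lemma Reverses.isRightLcm (hR : IsRightComplemented R) (hC : IsReversingComplete R)
    {u v u' v' : List S} (h : Reverses R (frac u v) (pos v' ++ neg u')) :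
    IsRightLcm (val R u) (val R v) (val R u * val R v') := by
  refine ⟨dvd_mul_right _ _, ⟨_, h.val_eq⟩, ?_⟩
  rintro d ⟨a, rfl⟩ ⟨b, hb⟩
  obtain ⟨v₁, rfl⟩ := val_surjective a
  obtain ⟨u₁, rfl⟩ := val_surjective b
  obtain ⟨u'', v'', w, h', -, hv⟩ := hC u v u₁ v₁ (by simpa using hb)
  obtain ⟨rfl, rfl⟩ := h.pos_append_neg_unique hR h'
  exact ⟨val R w, by rw [hv, val_append, mul_assoc]⟩

lemma exists_isRightLcm (hR : IsRightComplemented R) (hC : IsReversingComplete R)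
    (a b d : PMonoid R) (ha : a ∣ d) (hb : b ∣ d) : ∃ m, IsRightLcm a b m := by
  obtain ⟨u, rfl⟩ := val_surjective a
  obtain ⟨v, rfl⟩ := val_surjective b
  obtain ⟨u', v', h⟩ := succeeds_of_dvd hC ha hb
  exact ⟨_, h.isRightLcm hR hC⟩

/-- For a letter s, apply completeness to (s, s): since s⁻¹s reverses to ε, uniqueness gives u' = v'
= ε, and both cofactors equal w'. Letters generate the monoid. -/
lemma isLeftCancelMul (hR : IsRightComplemented R) (hC : IsReversingComplete R) :
    IsLeftCancelMul (PMonoid R) := by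
  have hletter : ∀ (s : S) (a b : PMonoid R), val R [s] * a = val R [s] * b → a = b := by
    intro s a b hab
    obtain ⟨v₁, rfl⟩ := val_surjective a
    obtain ⟨u₁, rfl⟩ := val_surjective b
    obtain ⟨u', v', w, h, hu, hv⟩ := hC [s] [s] u₁ v₁ (by rwa [val_append, val_append])
    have h' : Reverses R (frac [s] [s]) (pos [] ++ neg []) :=
      Relation.ReflTransGen.single ⟨[], [], s, s, [], [], Or.inl ⟨rfl, rfl, rfl⟩, rfl, rfl⟩
    obtain ⟨rfl, rfl⟩ := h'.pos_append_neg_unique hR h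
    rw [hu, hv]
  refine ⟨fun a b c hbc => ?_⟩
  obtain ⟨u, rfl⟩ := val_surjective a
  induction u with
  | nil => simpa using hbc
  | cons s u ih =>
    refine ih (hletter s _ _ ?_)
    simpa [val_cons s u, mul_assoc] using hbc

/-- In a noetherian left-cancellative presented monoid, an element is represented by finitely many
words. -/
lemma finite_setOf_val_eq [Finite S] (hR : IsRightComplemented R)
    (hN : IsNoetherianMonoid (PMonoid R)) [IsLeftCancelMul (PMonoid R)] (a : PMonoid R) :
    {w : List S | val R w = a}.Finite := by
  induction a using hN.induction with
  | _ a ih =>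
    have hs : ∀ s : S, {w : List S | val R [s] * val R w = a}.Finite := by
      intro s
      -- The quotient `b` is unique by left cancellation, and is a proper factor of `a` since no
      -- letter is invertible.
      by_cases h : ∃ b, val R [s] * b = a
      · obtain ⟨b, hb⟩ := h
        refine (ih b ⟨val R [s], 1, by simpa using hb,
          Or.inl (not_isUnit_val_singleton hR s)⟩).subset fun w hw => ?_
        exact mul_left_cancel (hw.trans hb.symm)
      · exact Set.finite_empty.subset fun w hw => h ⟨_, hw⟩
    refine ((Set.finite_singleton []).union
      (Set.finite_iUnion fun s => (hs s).image (List.cons s))).subset fun w hw => ?_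
    cases w with
    | nil => simp
    | cons s w =>
      refine Or.inr (Set.mem_iUnion.2 ⟨s, w, ?_, rfl⟩)
      rw [Set.mem_ofPred_eq, ← val_cons]
      exact hw

/-! ### Remainders, and termination of right-reversing. -/

lemma Succeeds.nil_left (v : List S) : Succeeds R [] v :=
  ⟨[], v, by simpa [frac] using Reverses.refl (R := R) (pos v)⟩

lemma Succeeds.nil_right (u : List S) : Succeeds R u [] :=
  ⟨u, [], by simpa [frac] using Reverses.refl (R := R) (neg u)⟩

lemma Reverses.frac_append_right {u v u' v' : List S}
    (h : Reverses R (frac u v) (pos v' ++ neg u')) (w : List S) :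
    Reverses R (frac u (v ++ w)) (pos v' ++ frac u' w ++ []) := by
  simpa [frac] using h.context [] (pos w)

lemma Reverses.frac_append_left {u v u' v' : List S}
    (h : Reverses R (frac u v) (pos v' ++ neg u')) (w : List S) :
    Reverses R (frac (u ++ w) v) ([] ++ frac w v' ++ neg u') := by
  simpa [frac] using h.context (neg w) []

lemma Succeeds.append_right {u v u' v' w : List S}
    (h : Reverses R (frac u v) (pos v' ++ neg u')) (h' : Succeeds R u' w) :
    Succeeds R u (v ++ w) := by
  obtain ⟨u'', w', h'⟩ := h'
  refine ⟨u'', v' ++ w', Reverses.trans (h.frac_append_right w) ?_⟩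
  have := h'.context (pos v') []
  simpa using this

lemma Reverses.append_left {u v u' v' w v'' w' : List S}
    (h : Reverses R (frac u v) (pos v' ++ neg u'))
    (h' : Reverses R (frac w v') (pos v'' ++ neg w')) :
    Reverses R (frac (u ++ w) v) (pos v'' ++ neg (u' ++ w')) := by
  refine Reverses.trans (h.frac_append_left w) ?_
  have := h'.context [] (neg u')
  simpa using this

/-- The positive words that right-reversing yields from a word and a letter. -/
def remainders (R : Relations S) : Set (List S) :=
  {w | ∃ (t : S) (z z' : List S), Reverses R (frac z [t]) (pos w ++ neg z')}

lemma singleton_mem_remainders (t : S) : [t] ∈ remainders R :=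
  ⟨t, [], [], by simpa [frac] using Reverses.refl (R := R) [(t, true)]⟩

/-- A word left by z⁻¹t represents c with z c a right-lcm of z and t: there are finitely many such c
for each letter t, and finitely many words for each c. -/
lemma finite_remainders [Finite S] (hR : IsRightComplemented R) (hC : IsReversingComplete R)
    (hN : IsNoetherianMonoid (PMonoid R)) {G : Set (PMonoid R)} (hfin : G.Finite)
    (hG : IsGarsideFamily G) : (remainders R).Finite := by
  have := isLeftCancelMul hR hC
  have hfc : ∀ t : S, (complements (val R [t])).Finite := fun t =>
    finite_complements (eq_one_of_mul_eq_one hR) (exists_isRightLcm hR hC) hfin hG _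
  refine (Set.finite_iUnion fun t => (hfc t).biUnion fun c _ =>
    finite_setOf_val_eq hR hN c).subset ?_
  rintro w ⟨t, z, z', h⟩
  simp only [Set.mem_iUnion]
  exact ⟨t, val R w, ⟨val R z, h.isRightLcm hR hC⟩, rfl⟩

/-- Feed `v` letter by letter: each successful letter leaves a new left word to face the rest of
`v`, and if no letter blocked, the whole pair would succeed. -/
lemma exists_reductionFactor_letter_right {u v : List S} (h : ¬ Succeeds R u v) :
    ∃ (u' : List S) (t : S), ReductionFactor R u v u' [t] ∧ ¬ Succeeds R u' [t] := by
  induction v generalizing u with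
  | nil => exact absurd (Succeeds.nil_right u) h
  | cons t v ih =>
    by_cases ht : Succeeds R u [t]
    · obtain ⟨u', v', hr⟩ := ht
      obtain ⟨u'', t', h1, h2⟩ := ih (u := u') fun h' => h (Succeeds.append_right hr h')
      exact ⟨u'', t', ReductionFactor.trans ⟨_, _, hr.frac_append_right v⟩ h1, h2⟩
    · exact ⟨u, t, ⟨[], pos v, by
        simpa [frac] using Reverses.refl (R := R) (neg u ++ (t, true) :: pos v)⟩, ht⟩

/-- The first letter of `u` is the one adjacent to `v` in u⁻¹v. If it passes, it turns the remainder
of some z⁻¹t into that of (zs)⁻¹t, so the set of remainders is never left. -/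
lemma exists_reductionFactor_letter_left {u v : List S} (h : ¬ Succeeds R u v)
    (hv : v ∈ remainders R) :
    ∃ (s : S) (w : List S), w ∈ remainders R ∧ ReductionFactor R u v [s] w ∧
      ¬ Succeeds R [s] w := by
  induction u generalizing v with
  | nil => exact absurd (Succeeds.nil_left v) h
  | cons s u ih =>
    by_cases hs : Succeeds R [s] v
    · obtain ⟨s', v', hr⟩ := hs
      obtain ⟨t, z, z', hz⟩ := hv
      obtain ⟨s'', w, h1, h2, h3⟩ := ih (v := v')
        (fun ⟨u'', v'', h'⟩ => h ⟨_, _, hr.append_left h'⟩) ⟨t, _, _, hz.append_left hr⟩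
      exact ⟨s'', w, h1, ReductionFactor.trans ⟨_, _, hr.frac_append_left u⟩ h2, h3⟩
    · exact ⟨s, v, hv, ⟨neg u, [], by
        simpa [frac] using Reverses.refl (R := R) (neg u ++ (s, false) :: pos v)⟩, hs⟩

lemma exists_reductionFactor_remainder {u v : List S} (h : ¬ Succeeds R u v) :
    ∃ (s : S) (w : List S), w ∈ remainders R ∧ ReductionFactor R u v [s] w ∧
      ¬ Succeeds R [s] w := by
  obtain ⟨u', t, h1, h2⟩ := exists_reductionFactor_letter_right h
  obtain ⟨s, w, hw, h3, h4⟩ := exists_reductionFactor_letter_left h2 (singleton_mem_remainders t)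
  exact ⟨s, w, hw, h1.trans h3, h4⟩

/-- Reversing s⁻¹t once provides the strictness; what it leaves against the rest of `v` cannot
succeed, so the preceding lemma applies to it. -/
lemma exists_strictReductionFactor_remainder {s : S} {v : List S} (h : ¬ Succeeds R [s] v)
    (hf : ¬ Failing R [s] v) :
    ∃ (s' : S) (w : List S), w ∈ remainders R ∧ StrictReductionFactor R [s] v [s'] w ∧
      ¬ Succeeds R [s'] w := by
  cases v with
  | nil => exact absurd (Succeeds.nil_right _) h
  | cons t v =>
    by_cases hd : ComplementDefined R s t
    · obtain ⟨x, y, hc⟩ := hd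
      have hstep : Step R (frac [s] [t]) (pos x ++ neg y) :=
        ⟨[], [], s, t, x, y, hc, by simp, by simp⟩
      have hstrict : StrictReductionFactor R [s] (t :: v) y v :=
        ⟨pos x, [], by
          have := hstep.reversesStrictly.context [] (pos v)
          simpa [frac] using this⟩
      obtain ⟨s', w, hw, h1, h2⟩ := exists_reductionFactor_remainder (u := y) (v := v)
        fun h' => h (Succeeds.append_right (v := [t]) (Relation.ReflTransGen.single hstep) h')
      exact ⟨s', w, hw, hstrict.trans_reductionFactor h1, h2⟩
    · exact absurd ⟨s, t, ⟨[], pos v, by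
        simpa [frac] using Reverses.refl (R := R) ((s, false) :: (t, true) :: pos v)⟩, hd⟩ hf

/-- If there are finitely many remainders, right-reversing succeeds, fails or is eventually
periodic. -/
lemma failing_or_eventuallyPeriodic_or_succeeds [Finite S] (hfin : (remainders R).Finite)
    (u v : List S) : Failing R u v ∨ EventuallyPeriodic R u v ∨ Succeeds R u v := by
  by_contra! h
  obtain ⟨hf, hp, hs⟩ := h
  let α := {p : S × List S // p.2 ∈ remainders R ∧ ReductionFactor R u v [p.1] p.2}
  -- A reflexive instance of `r` would be a periodic pair reachable from (u, v); without one, `r` is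
  -- a strict order on a finite set, and a minimal non-succeeding pair contradicts the existence of
  -- a strict descent.
  let r : α → α → Prop := fun a b => StrictReductionFactor R [b.1.1] b.1.2 [a.1.1] a.1.2
  have hα : Finite α := by
    have : ((Set.univ : Set S) ×ˢ remainders R).Finite := Set.finite_univ.prod hfin
    exact (this.subset fun p hp => ⟨trivial, hp.1⟩ :
      {p : S × List S | p.2 ∈ remainders R ∧ ReductionFactor R u v [p.1] p.2}.Finite)
  have : IsTrans α r := ⟨fun a b c hab hbc => hbc.trans hab⟩
  have : Std.Irrefl r := ⟨fun a ha => hp ⟨_, _, ha, a.2.2⟩⟩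
  have hwf : WellFounded r := Finite.wellFounded_of_trans_of_irrefl r
  obtain ⟨s, w, hw, h1, h2⟩ := exists_reductionFactor_remainder hs
  obtain ⟨⟨⟨s, w⟩, hw, hr⟩, h3, h4⟩ :=
    hwf.has_min {a : α | ¬ Succeeds R [a.1.1] a.1.2} ⟨⟨(s, w), hw, h1⟩, h2⟩
  obtain ⟨s', w', hw', h5, h6⟩ :=
    exists_strictReductionFactor_remainder h3 fun h => hf (h.of_reductionFactor hr)
  exact h4 ⟨(s', w'), hw', hr.trans h5.reductionFactor⟩ h6 h5

/-- When right-reversing is complete, any output of right-reversing is correct. -/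
lemma IsReversingOutput.isCorrectOutput (hR : IsRightComplemented R)
    (hC : IsReversingComplete R) {name : S → ℕ} {u v : List S} {o : Output}
    (ho : IsReversingOutput name R u v o) : IsCorrectOutput name R u v o := by
  by_cases h : ∃ m, val R u ∣ m ∧ val R v ∣ m
  · obtain ⟨m, hu, hv⟩ := h
    obtain ⟨u', v', hr, ho⟩ := (succeeds_of_dvd hC hu hv).output_ne_none hR ho
    exact Or.inl ⟨_, ho, by simpa using hr.isRightLcm hR hC⟩
  · refine Or.inr ⟨?_, h⟩
    obtain ⟨r, w, -, hr, ⟨u', v', rfl, -⟩ | ⟨-, ho⟩⟩ := ho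
    · have := hr.reverses hr.mem
      exact absurd ⟨_, dvd_mul_right _ _, _, this.val_eq⟩ h
    · exact ho

end Presented

/-! ### Invariance under injective renaming of letters. -/

section Naming

variable {S : Type*} {R : Relations S} {name : S → ℕ}

/-- The named form of a signed word. -/
def nameWord (name : S → ℕ) (w : SignedWord S) : SignedWord ℕ := w.map fun a => (name a.1, a.2)

/-- The named form of a list of relations. -/
def nameRelations (name : S → ℕ) (R : Relations S) : Relations ℕ :=
  R.map fun r => (r.1.map name, r.2.map name)

@[simp] lemma nameWord_append (w w' : SignedWord S) :
    nameWord name (w ++ w') = nameWord name w ++ nameWord name w' := by simp [nameWord]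

@[simp] lemma nameWord_pos (u : List S) : nameWord name (pos u) = pos (u.map name) := by
  simp [nameWord, pos]

@[simp] lemma nameWord_neg (u : List S) : nameWord name (neg u) = neg (u.map name) := by
  simp [nameWord, neg]

@[simp] lemma nameWord_frac (u v : List S) :
    nameWord name (frac u v) = frac (u.map name) (v.map name) := by simp [frac]

lemma nameWord_injective (hn : Function.Injective name) : Function.Injective (nameWord name) :=
  List.map_injective_iff.2 fun a b h => by
    obtain ⟨h1, h2⟩ := Prod.mk.inj h
    exact Prod.ext (hn h1) h2

lemma nameWord_eq_append {w : SignedWord S} {a b : SignedWord ℕ} (h : nameWord name w = a ++ b) :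
    ∃ a₀ b₀, w = a₀ ++ b₀ ∧ a = nameWord name a₀ ∧ b = nameWord name b₀ := by
  obtain ⟨a₀, b₀, h1, h2, h3⟩ := List.map_eq_append_iff.1 h
  exact ⟨a₀, b₀, h1, h2.symm, h3.symm⟩

lemma nameWord_eq_pos {w : SignedWord S} {a : List ℕ} (h : nameWord name w = pos a) :
    ∃ a₀, w = pos a₀ ∧ a = a₀.map name := by
  induction w generalizing a with
  | nil =>
    cases a with
    | nil => exact ⟨[], rfl, rfl⟩
    | cons _ _ => simp [nameWord] at h
  | cons x w ih =>
    cases a with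
    | nil => simp [nameWord] at h
    | cons n a =>
      simp only [nameWord, List.map_cons, pos_cons, List.cons.injEq] at h
      obtain ⟨a₀, rfl, rfl⟩ := ih h.2
      obtain ⟨s, b⟩ := x
      obtain ⟨rfl, rfl⟩ := Prod.mk.inj h.1
      exact ⟨s :: a₀, rfl, rfl⟩

lemma nameWord_eq_neg {w : SignedWord S} {a : List ℕ} (h : nameWord name w = neg a) :
    ∃ a₀, w = neg a₀ ∧ a = a₀.map name := by
  induction a generalizing w with
  | nil => exact ⟨[], by simpa [nameWord] using h, rfl⟩
  | cons n a ih =>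
    rw [neg_cons] at h
    obtain ⟨w₀, x, rfl, h1, h2⟩ := nameWord_eq_append h
    obtain ⟨a₀, rfl, rfl⟩ := ih h1.symm
    match x, h2 with
    | [(s, b)], h2 =>
      simp only [nameWord, List.map_cons, List.map_nil, List.cons.injEq, Prod.mk.injEq,
        and_true] at h2
      obtain ⟨rfl, rfl⟩ := h2
      exact ⟨s :: a₀, by simp, rfl⟩

lemma nameWord_eq_frac {w : SignedWord S} {a b : List ℕ} (h : nameWord name w = frac a b) :
    ∃ a₀ b₀, w = frac a₀ b₀ ∧ a = a₀.map name ∧ b = b₀.map name := by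
  obtain ⟨x, y, rfl, h1, h2⟩ := nameWord_eq_append h
  obtain ⟨a₀, rfl, rfl⟩ := nameWord_eq_neg h1.symm
  obtain ⟨b₀, rfl, rfl⟩ := nameWord_eq_pos h2.symm
  exact ⟨a₀, b₀, rfl, rfl, rfl⟩

lemma isRelation_nameRelations {x y : List ℕ} :
    IsRelation (nameRelations name R) x y ↔
      ∃ a b, x = a.map name ∧ y = b.map name ∧ IsRelation R a b := by
  simp only [IsRelation, nameRelations, List.mem_map, Prod.exists, Prod.mk.injEq]
  constructor
  · rintro (⟨a, b, h, rfl, rfl⟩ | ⟨a, b, h, rfl, rfl⟩)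
    · exact ⟨a, b, rfl, rfl, Or.inl h⟩
    · exact ⟨b, a, rfl, rfl, Or.inr h⟩
  · rintro ⟨a, b, rfl, rfl, h | h⟩
    · exact Or.inl ⟨a, b, h, rfl, rfl⟩
    · exact Or.inr ⟨b, a, h, rfl, rfl⟩

lemma complement_nameRelations (hn : Function.Injective name) {s t : S} {x y : List ℕ} :
    Complement (nameRelations name R) (name s) (name t) x y ↔
      ∃ a b, x = a.map name ∧ y = b.map name ∧ Complement R s t a b := by
  simp only [Complement, isRelation_nameRelations, hn.ne_iff, hn.eq_iff]
  constructor
  · rintro (⟨rfl, rfl, rfl⟩ | ⟨hne, a, b, ha, hb, h⟩)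
    · exact ⟨[], [], rfl, rfl, Or.inl ⟨rfl, rfl, rfl⟩⟩
    · obtain ⟨s', a, rfl, hs, rfl⟩ := List.map_eq_cons_iff.1 ha.symm
      obtain ⟨t', b, rfl, ht, rfl⟩ := List.map_eq_cons_iff.1 hb.symm
      obtain rfl := hn hs
      obtain rfl := hn ht
      exact ⟨a, b, rfl, rfl, Or.inr ⟨hne, h⟩⟩
  · rintro ⟨a, b, rfl, rfl, ⟨rfl, rfl, rfl⟩ | ⟨hne, h⟩⟩
    · exact Or.inl ⟨rfl, rfl, rfl⟩
    · exact Or.inr ⟨hne, s :: a, t :: b, rfl, rfl, h⟩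

lemma complementDefined_nameRelations (hn : Function.Injective name) {s t : S} :
    ComplementDefined (nameRelations name R) (name s) (name t) ↔ ComplementDefined R s t := by
  simp only [ComplementDefined, complement_nameRelations hn]
  constructor
  · rintro ⟨_, _, a, b, -, -, h⟩
    exact ⟨a, b, h⟩
  · rintro ⟨a, b, h⟩
    exact ⟨_, _, a, b, rfl, rfl, h⟩

/-- `name` need not be surjective, but every letter introduced by a step comes from a relation, so
all successors of a named word are named words. -/
lemma step_nameRelations (hn : Function.Injective name) {w : SignedWord S} {z : SignedWord ℕ} :
    Step (nameRelations name R) (nameWord name w) z ↔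
      ∃ w', z = nameWord name w' ∧ Step R w w' := by
  constructor
  · rintro ⟨p, q, s, t, x, y, hc, h, rfl⟩
    obtain ⟨w₁, q, rfl, h1, rfl⟩ := nameWord_eq_append h
    obtain ⟨p, w₂, rfl, rfl, h2⟩ := nameWord_eq_append h1.symm
    obtain ⟨a, b, rfl, ha, hb⟩ := nameWord_eq_frac h2.symm
    obtain ⟨s, rfl, rfl⟩ := List.map_eq_singleton_iff.1 ha.symm
    obtain ⟨t, rfl, rfl⟩ := List.map_eq_singleton_iff.1 hb.symm
    obtain ⟨x, y, rfl, rfl, hc₀⟩ := (complement_nameRelations hn).1 hc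
    exact ⟨p ++ (pos x ++ neg y) ++ q, by simp, p, q, s, t, x, y, hc₀, rfl, rfl⟩
  · rintro ⟨w', rfl, p, q, s, t, x, y, hc, rfl, rfl⟩
    exact ⟨nameWord name p, nameWord name q, name s, name t, _, _,
      (complement_nameRelations hn).2 ⟨x, y, rfl, rfl, hc⟩, by simp, by simp⟩

lemma step_nameWord_iff (hn : Function.Injective name) {w w' : SignedWord S} :
    Step (nameRelations name R) (nameWord name w) (nameWord name w') ↔ Step R w w' := by
  rw [step_nameRelations hn]
  constructor
  · rintro ⟨w'', h, hs⟩
    rwa [nameWord_injective hn h]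
  · exact fun h => ⟨w', rfl, h⟩

lemma reversesStrictly_nameWord_iff (hn : Function.Injective name) {w w' : SignedWord S} :
    ReversesStrictly (nameRelations name R) (nameWord name w) (nameWord name w') ↔
      ReversesStrictly R w w' := by
  constructor
  · intro h
    suffices ∀ z, ReversesStrictly (nameRelations name R) (nameWord name w) z →
        ∃ w', z = nameWord name w' ∧ ReversesStrictly R w w' by
      obtain ⟨w'', h1, h2⟩ := this _ h
      rwa [nameWord_injective hn h1]
    intro z hz
    induction hz with
    | single h =>
      obtain ⟨w', rfl, hs⟩ := (step_nameRelations hn).1 h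
      exact ⟨w', rfl, Relation.TransGen.single hs⟩
    | tail _ h ih =>
      obtain ⟨w₁, rfl, h1⟩ := ih
      obtain ⟨w', rfl, hs⟩ := (step_nameRelations hn).1 h
      exact ⟨w', rfl, Relation.TransGen.tail h1 hs⟩
  · intro h
    exact Relation.TransGen.lift (nameWord name) (fun _ _ h => (step_nameWord_iff hn).2 h) _ _ h

lemma exists_isChain_of_nameRelations (hn : Function.Injective name) {w : SignedWord S}
    {r : List (SignedWord ℕ)}
    (h : (nameWord name w :: r).IsChain (Step (nameRelations name R))) :
    ∃ r₀, r = nameRun name r₀ ∧ (w :: r₀).IsChain (Step R) := by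
  induction r generalizing w with
  | nil => exact ⟨[], rfl, by simp⟩
  | cons z r ih =>
    rw [List.isChain_cons_cons] at h
    obtain ⟨w', rfl, hs⟩ := (step_nameRelations hn).1 h.1
    obtain ⟨r₀, rfl, hr⟩ := ih h.2
    exact ⟨w' :: r₀, rfl, List.isChain_cons_cons.2 ⟨hs, hr⟩⟩

lemma isRun_nameRelations (hn : Function.Injective name) {u v : List S}
    {r : List (SignedWord ℕ)} {w : SignedWord ℕ} :
    IsRun (nameRelations name R) (u.map name) (v.map name) r w ↔
      ∃ r₀ w₀, r = nameRun name r₀ ∧ w = nameWord name w₀ ∧ IsRun R u v r₀ w₀ := by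
  constructor
  · rintro ⟨h1, h2, h3⟩
    cases r with
    | nil => simp at h1
    | cons z r =>
      obtain rfl : z = nameWord name (frac u v) := by simpa using h1
      obtain ⟨r₀, rfl, hr⟩ := exists_isChain_of_nameRelations hn h2
      obtain ⟨w₀, hw⟩ : ∃ w₀, (frac u v :: r₀).getLast? = some w₀ :=
        ⟨_, List.getLast?_eq_some_getLast (List.cons_ne_nil _ _)⟩
      refine ⟨frac u v :: r₀, w₀, rfl, ?_, rfl, hr, hw⟩
      have h4 : (nameRun name (frac u v :: r₀)).getLast? = some w := h3
      rw [nameRun, List.getLast?_map, hw] at h4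
      exact (Option.some.inj h4).symm
  · rintro ⟨r₀, w₀, rfl, rfl, h1, h2, h3⟩
    refine ⟨?_, ?_, ?_⟩
    · rw [nameRun, List.head?_map, h1, Option.map_some]
      exact congrArg some (nameWord_frac u v)
    · exact (List.isChain_map (nameWord name)).2 (h2.imp fun a b h => (step_nameWord_iff hn).2 h)
    · rw [nameRun, List.getLast?_map, h3]
      rfl

lemma showsFailure_nameWord (hn : Function.Injective name) {w : SignedWord S} :
    ShowsFailure (nameRelations name R) (nameWord name w) ↔ ShowsFailure R w := by
  constructor
  · rintro ⟨s, t, p, q, h, hd⟩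
    obtain ⟨w₁, q, rfl, h1, rfl⟩ := nameWord_eq_append h
    obtain ⟨p, w₂, rfl, rfl, h2⟩ := nameWord_eq_append h1.symm
    obtain ⟨a, b, rfl, ha, hb⟩ := nameWord_eq_frac h2.symm
    obtain ⟨s, rfl, rfl⟩ := List.map_eq_singleton_iff.1 ha.symm
    obtain ⟨t, rfl, rfl⟩ := List.map_eq_singleton_iff.1 hb.symm
    exact ⟨s, t, p, q, rfl, fun h => hd ((complementDefined_nameRelations hn).2 h)⟩
  · rintro ⟨s, t, p, q, rfl, hd⟩
    exact ⟨name s, name t, nameWord name p, nameWord name q, by simp,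
      fun h => hd ((complementDefined_nameRelations hn).1 h)⟩

lemma showsPeriod_nameRun (hn : Function.Injective name) {r : List (SignedWord S)}
    {w : SignedWord S} :
    ShowsPeriod (nameRelations name R) (nameRun name r) (nameWord name w) ↔
      ShowsPeriod R r w := by
  constructor
  · rintro ⟨u₁, v₁, p, q, x, y, hm, h, hs⟩
    obtain ⟨z, hz, hz'⟩ := List.mem_map.1 hm
    obtain ⟨w₁, q, rfl, h1, rfl⟩ := nameWord_eq_append (show nameWord name z = _ from hz')
    obtain ⟨p, w₂, rfl, rfl, h2⟩ := nameWord_eq_append h1.symm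
    obtain ⟨a, b, rfl, rfl, rfl⟩ := nameWord_eq_frac h2.symm
    obtain ⟨w₃, q', rfl, h3, h4⟩ := nameWord_eq_append h
    obtain ⟨p', w₄, rfl, h5, h6⟩ := nameWord_eq_append h3.symm
    obtain ⟨w₅, y, rfl, h7, rfl⟩ := nameWord_eq_append h6.symm
    obtain ⟨x, w₆, rfl, rfl, h8⟩ := nameWord_eq_append h7.symm
    rw [← nameWord_frac] at h8
    -- The contexts and the factor have been lifted twice, from a word of the run and from its last
    -- word; injectivity identifies the lifts.
    obtain rfl := nameWord_injective hn h4
    obtain rfl := nameWord_injective hn h5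
    obtain rfl := nameWord_injective hn h8
    refine ⟨a, b, p, q, x, y, hz, rfl, (reversesStrictly_nameWord_iff hn).1 ?_⟩
    simpa using hs
  · rintro ⟨u₁, v₁, p, q, x, y, hm, rfl, hs⟩
    refine ⟨u₁.map name, v₁.map name, nameWord name p, nameWord name q, nameWord name x,
      nameWord name y, List.mem_map.2 ⟨_, hm, ?_⟩, by simp, ?_⟩
    · exact (by simp : nameWord name (p ++ frac u₁ v₁ ++ q) =
        nameWord name p ++ frac (u₁.map name) (v₁.map name) ++ nameWord name q)
    · simpa using (reversesStrictly_nameWord_iff hn).2 hs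

lemma nameWord_eq_pos_append_neg {w : SignedWord S} {u v : List ℕ}
    (h : nameWord name w = pos v ++ neg u) :
    ∃ u₀ v₀, w = pos v₀ ++ neg u₀ ∧ u = u₀.map name ∧ v = v₀.map name := by
  obtain ⟨x, y, rfl, h1, h2⟩ := nameWord_eq_append h
  obtain ⟨v₀, rfl, rfl⟩ := nameWord_eq_pos h1.symm
  obtain ⟨u₀, rfl, rfl⟩ := nameWord_eq_neg h2.symm
  exact ⟨u₀, v₀, rfl, rfl, rfl⟩

lemma nameRun_id (r : List (SignedWord ℕ)) : nameRun id r = r := by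
  simp [nameRun]

/-- Outputs do not depend on whether right-reversing is run on letters or on their names. -/
lemma isReversingOutput_nameRelations (hn : Function.Injective name) {u v : List S}
    {o : Output} :
    IsReversingOutput id (nameRelations name R) (u.map name) (v.map name) o ↔
      IsReversingOutput name R u v o := by
  simp only [IsReversingOutput, nameRun_id, List.map_id]
  constructor
  · rintro ⟨r, w, ho, hr, h⟩
    obtain ⟨r, w, rfl, rfl, hr₀⟩ := (isRun_nameRelations hn).1 hr
    refine ⟨r, w, ho, hr₀, ?_⟩
    rw [showsFailure_nameWord hn, showsPeriod_nameRun hn] at h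
    refine h.imp_left ?_
    rintro ⟨u', v', hw, ho'⟩
    obtain ⟨u', v', rfl, rfl, rfl⟩ := nameWord_eq_pos_append_neg hw
    exact ⟨u', v', rfl, by simpa using ho'⟩
  · rintro ⟨r, w, ho, hr, h⟩
    refine ⟨_, _, ho, (isRun_nameRelations hn).2 ⟨r, w, rfl, rfl, hr⟩, ?_⟩
    rw [showsFailure_nameWord hn, showsPeriod_nameRun hn]
    refine h.imp_left ?_
    rintro ⟨u', v', rfl, ho'⟩
    exact ⟨u'.map name, v'.map name, by simp, by simpa using ho'⟩

end Naming

/-! ### Finite certificates for outputs. -/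

section Replay

/-- A description of a right-reversing step: the prefix, the suffix, the two letters that are
reversed, and the two words that replace them. -/
abbrev StepData : Type :=
  (SignedWord ℕ × SignedWord ℕ) × (ℕ × ℕ) × (List ℕ × List ℕ)

/-- The signed word to which a step is applied. -/
def StepData.source (d : StepData) : SignedWord ℕ := d.1.1 ++ frac [d.2.1.1] [d.2.1.2] ++ d.1.2

/-- The signed word that results from a step. -/
def StepData.target (d : StepData) : SignedWord ℕ :=
  d.1.1 ++ (pos d.2.2.1 ++ neg d.2.2.2) ++ d.1.2

/-- The step is an instance of the complement. -/
def StepData.Valid (R : Relations ℕ) (d : StepData) : Prop :=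
  Complement R d.2.1.1 d.2.1.2 d.2.2.1 d.2.2.2

/-- The list `l` describes a right-reversing sequence from `w` to `w'`. -/
def IsReplay (R : Relations ℕ) (w : SignedWord ℕ) (l : List StepData) (w' : SignedWord ℕ) : Prop :=
  l.map StepData.source ++ [w'] = w :: l.map StepData.target ∧ ∀ d ∈ l, d.Valid R

variable {R : Relations ℕ}

lemma StepData.Valid.step {d : StepData} (h : d.Valid R) : Step R d.source d.target :=
  ⟨_, _, _, _, _, _, h, rfl, rfl⟩

/-- The single list equation in `IsReplay`, shifted by one place, says that each source is the
preceding target. -/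
lemma IsReplay.isChain {w w' : SignedWord ℕ} {l : List StepData} (h : IsReplay R w l w') :
    (w :: l.map StepData.target).IsChain (Step R) ∧
      (w :: l.map StepData.target).getLast? = some w' := by
  induction l generalizing w with
  | nil =>
    obtain ⟨h, -⟩ := h
    obtain rfl : w' = w := by simpa using h
    simp
  | cons d l ih =>
    obtain ⟨h1, h2⟩ := h
    simp only [List.map_cons, List.cons_append, List.cons.injEq] at h1
    obtain ⟨rfl, h1⟩ := h1
    obtain ⟨h3, h4⟩ := ih ⟨h1, fun d hd => h2 d (List.mem_cons_of_mem _ hd)⟩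
    refine ⟨List.isChain_cons_cons.2 ⟨(h2 d List.mem_cons_self).step, h3⟩, ?_⟩
    rw [List.map_cons, List.getLast?_cons_cons]
    exact h4

lemma exists_isReplay_of_isChain {w w' : SignedWord ℕ} {r : List (SignedWord ℕ)}
    (h : (w :: r).IsChain (Step R)) (h' : (w :: r).getLast? = some w') :
    ∃ l, r = l.map StepData.target ∧ IsReplay R w l w' := by
  induction r generalizing w with
  | nil =>
    obtain rfl : w = w' := by simpa using h'
    exact ⟨[], rfl, rfl, by simp⟩
  | cons z r ih =>
    rw [List.isChain_cons_cons] at h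
    rw [List.getLast?_cons_cons] at h'
    obtain ⟨⟨p, q, s, t, x, y, hc, rfl, rfl⟩, h⟩ := h
    obtain ⟨l, rfl, h1, h2⟩ := ih h h'
    refine ⟨((p, q), (s, t), (x, y)) :: l, rfl, ?_, ?_⟩
    · rw [List.map_cons, List.cons_append, h1]
      rfl
    · exact List.forall_mem_cons.2 ⟨hc, h2⟩

lemma isRun_iff_exists_isReplay {u v : List ℕ} {r : List (SignedWord ℕ)} {w : SignedWord ℕ} :
    IsRun R u v r w ↔
      ∃ l, r = frac u v :: l.map StepData.target ∧ IsReplay R (frac u v) l w := by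
  constructor
  · rintro ⟨h1, h2, h3⟩
    cases r with
    | nil => simp at h1
    | cons z r =>
      obtain rfl : z = frac u v := by simpa using h1
      obtain ⟨l, rfl, hl⟩ := exists_isReplay_of_isChain h2 h3
      exact ⟨l, rfl, hl⟩
  · rintro ⟨l, rfl, hl⟩
    exact ⟨rfl, hl.isChain.1, hl.isChain.2⟩

lemma reversesStrictly_iff_exists_isReplay {w w' : SignedWord ℕ} :
    ReversesStrictly R w w' ↔ ∃ l, l ≠ [] ∧ IsReplay R w l w' := by
  constructor
  · intro h
    obtain ⟨z, hz, h⟩ := Relation.TransGen.head'_iff.1 h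
    obtain ⟨r, hr, hlast⟩ := List.exists_isChain_cons_of_relationReflTransGen h
    have h' : (w :: z :: r).IsChain (Step R) := List.isChain_cons_cons.2 ⟨hz, hr⟩
    obtain ⟨l, hl, hrep⟩ := exists_isReplay_of_isChain h' (w' := w') (by
      rw [List.getLast?_cons_cons, List.getLast?_eq_some_getLast (List.cons_ne_nil _ _), hlast])
    exact ⟨l, by rintro rfl; simp at hl, hrep⟩
  · rintro ⟨l, hl, hrep⟩
    obtain ⟨h1, h2⟩ := hrep.isChain
    cases l with
    | nil => exact absurd rfl hl
    | cons d l =>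
      rw [List.map_cons] at h1 h2
      rw [List.isChain_cons_cons] at h1
      rw [List.getLast?_cons_cons] at h2
      exact Relation.TransGen.head' h1.1 (reverses_of_isChain h1.2 (List.mem_of_getLast? h2))

/-- The evidence for an outcome of right-reversing, besides the run: the two words and the contexts
that occur in failure or periodicity, a pair of letters, and a second run. -/
abbrev Evidence : Type :=
  (List ℕ × List ℕ) × (SignedWord ℕ × SignedWord ℕ) × (SignedWord ℕ × SignedWord ℕ) ×
    (ℕ × ℕ) × List StepData

/-- A certificate for an output: the description of a run, its last word, the answer, and the
evidence for it. -/
abbrev Certificate : Type := (List StepData × SignedWord ℕ × Option (List ℕ)) × Evidence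

/-- The output that is certified. -/
def Certificate.output (i : Input) (c : Certificate) : Output :=
  (frac i.2.1 i.2.2 :: c.1.1.map StepData.target, c.1.2.2)

/-- The evidence shows that right-reversing has succeeded. -/
def Certificate.Success (i : Input) (c : Certificate) : Prop :=
  c.1.2.1 = pos c.2.1.2 ++ neg c.2.1.1 ∧ c.1.2.2 = some (i.2.1 ++ c.2.1.2)

/-- The evidence shows that right-reversing has failed. -/
def Certificate.Failure (i : Input) (c : Certificate) : Prop :=
  (c.1.2.1 = c.2.2.1.1 ++ frac [c.2.2.2.2.1.1] [c.2.2.2.2.1.2] ++ c.2.2.1.2 ∧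
    ¬ ComplementDefined i.1 c.2.2.2.2.1.1 c.2.2.2.2.1.2) ∧ c.1.2.2 = none

/-- The evidence shows that right-reversing is eventually periodic. -/
def Certificate.Period (i : Input) (c : Certificate) : Prop :=
  (c.2.2.1.1 ++ frac c.2.1.1 c.2.1.2 ++ c.2.2.1.2 ∈ (c.output i).1 ∧
    c.1.2.1 = c.2.2.1.1 ++ (c.2.2.2.1.1 ++ frac c.2.1.1 c.2.1.2 ++ c.2.2.2.1.2) ++ c.2.2.1.2 ∧
    c.2.2.2.2.2 ≠ [] ∧ IsReplay i.1 (frac c.2.1.1 c.2.1.2) c.2.2.2.2.2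
      (c.2.2.2.1.1 ++ frac c.2.1.1 c.2.1.2 ++ c.2.2.2.1.2)) ∧ c.1.2.2 = none

/-- The certificate is valid. -/
def Certificate.Valid (i : Input) (c : Certificate) : Prop :=
  IsReplay i.1 (frac i.2.1 i.2.2) c.1.1 c.1.2.1 ∧ (c.Success i ∨ c.Failure i ∨ c.Period i)

/-- All existential witnesses are moved into the certificate, so that checking one needs no
unbounded search. -/
lemma isReversingOutput_iff_exists_certificate {u v : List ℕ} {o : Output} :
    IsReversingOutput id R u v o ↔
      ∃ c : Certificate, c.Valid (R, u, v) ∧ c.output (R, u, v) = o := by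
  constructor
  · rintro ⟨r, w, h1, hr, h⟩
    rw [nameRun_id] at h1
    obtain ⟨l, rfl, hl⟩ := isRun_iff_exists_isReplay.1 hr
    have ho : (frac u v :: l.map StepData.target, o.2) = o := Prod.ext h1.symm rfl
    rcases h with ⟨u', v', rfl, h⟩ | ⟨⟨s, t, p, q, rfl, hd⟩ | ⟨u₁, v₁, p, q, x, y, hm, rfl, hs⟩, h⟩
    -- Evidence slots irrelevant to the case at hand receive dummy values.
    · exact ⟨((l, _, o.2), (u', v'), ([], []), ([], []), (0, 0), []),
        ⟨hl, Or.inl ⟨rfl, by simpa using h⟩⟩, ho⟩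
    · exact ⟨((l, _, o.2), ([], []), (p, q), ([], []), (s, t), []),
        ⟨hl, Or.inr (Or.inl ⟨⟨rfl, hd⟩, h⟩)⟩, ho⟩
    · obtain ⟨l', hne, hl'⟩ := reversesStrictly_iff_exists_isReplay.1 hs
      exact ⟨((l, _, o.2), (u₁, v₁), (p, q), (x, y), (0, 0), l'),
        ⟨hl, Or.inr (Or.inr ⟨⟨hm, rfl, hne, hl'⟩, h⟩)⟩, ho⟩
  · rintro ⟨c, ⟨hl, h⟩, rfl⟩
    refine ⟨_, _, (nameRun_id _).symm, isRun_iff_exists_isReplay.2 ⟨_, rfl, hl⟩, ?_⟩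
    rcases h with ⟨h1, h2⟩ | ⟨⟨h1, h2⟩, h3⟩ | ⟨⟨h1, h2, h3, h4⟩, h5⟩
    · exact Or.inl ⟨_, _, h1, by simpa [Certificate.output] using h2⟩
    · exact Or.inr ⟨Or.inl ⟨_, _, _, _, h1, h2⟩, h3⟩
    · exact Or.inr ⟨Or.inr ⟨_, _, _, _, _, _, h1, h2,
        reversesStrictly_iff_exists_isReplay.2 ⟨_, h3, h4⟩⟩, h5⟩

end Replay

/-! ### Primitive recursive checking and the search. -/

section Primrec

variable {α : Type*} [Primcodable α]

lemma primrec_pos : Primrec (pos : List ℕ → SignedWord ℕ) :=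
  Primrec.list_map Primrec.id (Primrec.snd.pair (Primrec.const true))

lemma primrec_neg : Primrec (neg : List ℕ → SignedWord ℕ) :=
  Primrec.list_reverse.comp
    (Primrec.list_map Primrec.id (Primrec.snd.pair (Primrec.const false)))

lemma primrec_append {β : Type*} [Primcodable β] {f g : α → List β} (hf : Primrec f)
    (hg : Primrec g) : Primrec fun a => f a ++ g a :=
  Primrec.list_append.comp hf hg

lemma primrec_singleton {β : Type*} [Primcodable β] {f : α → β} (hf : Primrec f) :
    Primrec fun a => [f a] :=
  Primrec.list_cons.comp hf (Primrec.const [])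

lemma primrec_frac {f g : α → List ℕ} (hf : Primrec f) (hg : Primrec g) :
    Primrec fun a => frac (f a) (g a) :=
  primrec_append (primrec_neg.comp hf) (primrec_pos.comp hg)

lemma primrecPred_eq {β : Type*} [Primcodable β] {f g : α → β} (hf : Primrec f)
    (hg : Primrec g) : PrimrecPred fun a => f a = g a :=
  Primrec.eq.comp hf hg

lemma primrecPred_mem {β : Type*} [Primcodable β] {f : α → β} {g : α → List β} (hf : Primrec f)
    (hg : Primrec g) : PrimrecPred fun a => f a ∈ g a :=
  ((PrimrecRel.exists_mem_list Primrec.eq).comp hg hf).of_eq fun a => by simp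

lemma primrecPred_isRelation {R : α → Relations ℕ} {x y : α → List ℕ} (hR : Primrec R)
    (hx : Primrec x) (hy : Primrec y) : PrimrecPred fun a => IsRelation (R a) (x a) (y a) :=
  (primrecPred_mem (hx.pair hy) hR).or (primrecPred_mem (hy.pair hx) hR)

lemma primrecPred_complement {R : α → Relations ℕ} {s t : α → ℕ} {x y : α → List ℕ}
    (hR : Primrec R) (hs : Primrec s) (ht : Primrec t) (hx : Primrec x) (hy : Primrec y) :
    PrimrecPred fun a => Complement (R a) (s a) (t a) (x a) (y a) :=
  ((primrecPred_eq hs ht).and ((primrecPred_eq hx (Primrec.const [])).and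
    (primrecPred_eq hy (Primrec.const [])))).or
    ((primrecPred_eq hs ht).not.and (primrecPred_isRelation hR (Primrec.list_cons.comp hs hx)
      (Primrec.list_cons.comp ht hy)))

/-- Definedness of θ depends only on the first letters of the relations; this replaces the unbounded
quantifiers over words by a search in the list `R`. -/
lemma complementDefined_iff {R : Relations ℕ} {s t : ℕ} :
    ComplementDefined R s t ↔ s = t ∨ ∃ r ∈ R,
      (r.1.head? = some s ∧ r.2.head? = some t) ∨ (r.1.head? = some t ∧ r.2.head? = some s) := by
  simp only [List.head?_eq_some_iff]
  constructor
  · rintro ⟨x, y, ⟨h, -, -⟩ | ⟨-, h | h⟩⟩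
    · exact Or.inl h
    · exact Or.inr ⟨_, h, Or.inl ⟨⟨x, rfl⟩, ⟨y, rfl⟩⟩⟩
    · exact Or.inr ⟨_, h, Or.inr ⟨⟨y, rfl⟩, ⟨x, rfl⟩⟩⟩
  · intro h
    by_cases hst : s = t
    · exact ⟨[], [], Or.inl ⟨hst, rfl, rfl⟩⟩
    · obtain ⟨⟨a, b⟩, hr, ⟨⟨x, hx⟩, ⟨y, hy⟩⟩ | ⟨⟨y, hy⟩, ⟨x, hx⟩⟩⟩ := h.resolve_left hst
      · exact ⟨x, y, Or.inr ⟨hst, Or.inl (hx ▸ hy ▸ hr)⟩⟩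
      · exact ⟨x, y, Or.inr ⟨hst, Or.inr (hx ▸ hy ▸ hr)⟩⟩

lemma primrecPred_complementDefined {R : α → Relations ℕ} {s t : α → ℕ}
    (hR : Primrec R) (hs : Primrec s) (ht : Primrec t) :
    PrimrecPred fun a => ComplementDefined (R a) (s a) (t a) := by
  have hhead : PrimrecRel fun (r : List ℕ × List ℕ) (p : ℕ × ℕ) =>
      (r.1.head? = some p.1 ∧ r.2.head? = some p.2) ∨
        (r.1.head? = some p.2 ∧ r.2.head? = some p.1) := by
    have h1 : Primrec fun x : (List ℕ × List ℕ) × ℕ × ℕ => x.1.1.head? :=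
      Primrec.list_head?.comp (Primrec.fst.comp Primrec.fst)
    have h2 : Primrec fun x : (List ℕ × List ℕ) × ℕ × ℕ => x.1.2.head? :=
      Primrec.list_head?.comp (Primrec.snd.comp Primrec.fst)
    have h3 : Primrec fun x : (List ℕ × List ℕ) × ℕ × ℕ => some x.2.1 :=
      Primrec.option_some.comp (Primrec.fst.comp Primrec.snd)
    have h4 : Primrec fun x : (List ℕ × List ℕ) × ℕ × ℕ => some x.2.2 :=
      Primrec.option_some.comp (Primrec.snd.comp Primrec.snd)
    exact ((primrecPred_eq h1 h3).and (primrecPred_eq h2 h4)).or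
      ((primrecPred_eq h1 h4).and (primrecPred_eq h2 h3))
  exact ((primrecPred_eq hs ht).or
    ((PrimrecRel.exists_mem_list hhead).comp hR (hs.pair ht))).of_eq fun a =>
      complementDefined_iff.symm

lemma primrec_source : Primrec StepData.source :=
  primrec_append (primrec_append (Primrec.fst.comp Primrec.fst)
    (primrec_frac (primrec_singleton (Primrec.fst.comp (Primrec.fst.comp Primrec.snd)))
      (primrec_singleton (Primrec.snd.comp (Primrec.fst.comp Primrec.snd)))))
    (Primrec.snd.comp Primrec.fst)

lemma primrec_target : Primrec StepData.target :=
  primrec_append (primrec_append (Primrec.fst.comp Primrec.fst)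
    (primrec_append (primrec_pos.comp (Primrec.fst.comp (Primrec.snd.comp Primrec.snd)))
      (primrec_neg.comp (Primrec.snd.comp (Primrec.snd.comp Primrec.snd)))))
    (Primrec.snd.comp Primrec.fst)

lemma primrecPred_isReplay {R : α → Relations ℕ} {w w' : α → SignedWord ℕ}
    {l : α → List StepData} (hR : Primrec R) (hw : Primrec w) (hl : Primrec l)
    (hw' : Primrec w') : PrimrecPred fun a => IsReplay (R a) (w a) (l a) (w' a) := by
  have hvalid : PrimrecRel fun (d : StepData) (R : Relations ℕ) => d.Valid R := by
    have h : Primrec fun x : StepData × Relations ℕ => x.1.2 := Primrec.snd.comp Primrec.fst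
    exact primrecPred_complement Primrec.snd (Primrec.fst.comp (Primrec.fst.comp h))
      (Primrec.snd.comp (Primrec.fst.comp h)) (Primrec.fst.comp (Primrec.snd.comp h))
      (Primrec.snd.comp (Primrec.snd.comp h))
  exact (primrecPred_eq
    (primrec_append (Primrec.list_map hl (primrec_source.comp₂ Primrec₂.right))
      (primrec_singleton hw'))
    (Primrec.list_cons.comp hw (Primrec.list_map hl (primrec_target.comp₂ Primrec₂.right)))).and
    ((PrimrecRel.forall_mem_list hvalid).comp hl hR)

lemma primrec_output : Primrec fun x : Input × Certificate => x.2.output x.1 := by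
  have hi : Primrec fun x : Input × Certificate => x.1.2 := Primrec.snd.comp Primrec.fst
  have hc : Primrec fun x : Input × Certificate => x.2.1 := Primrec.fst.comp Primrec.snd
  exact Primrec.pair
    (Primrec.list_cons.comp (primrec_frac (Primrec.fst.comp hi) (Primrec.snd.comp hi))
      (Primrec.list_map (Primrec.fst.comp hc) (primrec_target.comp₂ Primrec₂.right)))
    (Primrec.snd.comp (Primrec.snd.comp hc))

lemma primrecPred_valid : PrimrecPred fun x : Input × Certificate => x.2.Valid x.1 := by
  have hR : Primrec fun x : Input × Certificate => x.1.1 := Primrec.fst.comp Primrec.fst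
  have hi : Primrec fun x : Input × Certificate => x.1.2 := Primrec.snd.comp Primrec.fst
  have hu : Primrec fun x : Input × Certificate => x.1.2.1 := Primrec.fst.comp hi
  have hv : Primrec fun x : Input × Certificate => x.1.2.2 := Primrec.snd.comp hi
  have hc : Primrec fun x : Input × Certificate => x.2.1 := Primrec.fst.comp Primrec.snd
  have hl : Primrec fun x : Input × Certificate => x.2.1.1 := Primrec.fst.comp hc
  have hw : Primrec fun x : Input × Certificate => x.2.1.2.1 :=
    Primrec.fst.comp (Primrec.snd.comp hc)
  have hans : Primrec fun x : Input × Certificate => x.2.1.2.2 :=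
    Primrec.snd.comp (Primrec.snd.comp hc)
  have he : Primrec fun x : Input × Certificate => x.2.2 := Primrec.snd.comp Primrec.snd
  have ha : Primrec fun x : Input × Certificate => x.2.2.1.1 :=
    Primrec.fst.comp (Primrec.fst.comp he)
  have hb : Primrec fun x : Input × Certificate => x.2.2.1.2 :=
    Primrec.snd.comp (Primrec.fst.comp he)
  have he₂ : Primrec fun x : Input × Certificate => x.2.2.2 := Primrec.snd.comp he
  have hp : Primrec fun x : Input × Certificate => x.2.2.2.1.1 :=
    Primrec.fst.comp (Primrec.fst.comp he₂)
  have hq : Primrec fun x : Input × Certificate => x.2.2.2.1.2 :=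
    Primrec.snd.comp (Primrec.fst.comp he₂)
  have he₃ : Primrec fun x : Input × Certificate => x.2.2.2.2 := Primrec.snd.comp he₂
  have hx : Primrec fun x : Input × Certificate => x.2.2.2.2.1.1 :=
    Primrec.fst.comp (Primrec.fst.comp he₃)
  have hy : Primrec fun x : Input × Certificate => x.2.2.2.2.1.2 :=
    Primrec.snd.comp (Primrec.fst.comp he₃)
  have he₄ : Primrec fun x : Input × Certificate => x.2.2.2.2.2 := Primrec.snd.comp he₃
  have hs : Primrec fun x : Input × Certificate => x.2.2.2.2.2.1.1 :=
    Primrec.fst.comp (Primrec.fst.comp he₄)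
  have ht : Primrec fun x : Input × Certificate => x.2.2.2.2.2.1.2 :=
    Primrec.snd.comp (Primrec.fst.comp he₄)
  have hl' : Primrec fun x : Input × Certificate => x.2.2.2.2.2.2 := Primrec.snd.comp he₄
  have hnone : PrimrecPred fun x : Input × Certificate => x.2.1.2.2 = none :=
    primrecPred_eq hans (Primrec.const none)
  have hfab : Primrec fun x : Input × Certificate => frac x.2.2.1.1 x.2.2.1.2 :=
    primrec_frac ha hb
  have hxy := primrec_append (primrec_append hx hfab) hy
  refine (primrecPred_isReplay hR (primrec_frac hu hv) hl hw).and (PrimrecPred.or ?_ (.or ?_ ?_))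
  · exact (primrecPred_eq hw (primrec_append (primrec_pos.comp hb) (primrec_neg.comp ha))).and
      (primrecPred_eq hans (Primrec.option_some.comp (primrec_append hu hb)))
  · exact ((primrecPred_eq hw (primrec_append (primrec_append hp
      (primrec_frac (primrec_singleton hs) (primrec_singleton ht))) hq)).and
      (primrecPred_complementDefined hR hs ht).not).and hnone
  · exact ((primrecPred_mem (primrec_append (primrec_append hp hfab) hq)
      (Primrec.fst.comp primrec_output)).and
      ((primrecPred_eq hw (primrec_append (primrec_append hp hxy) hq)).and
      ((primrecPred_eq hl' (Primrec.const [])).not.and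
      (primrecPred_isReplay hR hfab hl' hxy)))).and hnone

open scoped Classical in
/-- The search for a certificate, at stage `n`. -/
noncomputable def searchStage (i : Input) (n : ℕ) : Option Output :=
  (Encodable.decode n : Option Certificate).bind fun c =>
    if c.Valid i then some (c.output i) else none

lemma primrec_searchStage : Primrec₂ searchStage := by
  classical
  have h : Primrec fun x : (Input × ℕ) × Certificate => (x.1.1, x.2) :=
    (Primrec.fst.comp Primrec.fst).pair Primrec.snd
  refine Primrec.option_bind (Primrec.decode.comp Primrec.snd) ?_
  exact Primrec.ite (primrecPred_valid.comp h)
    (Primrec.option_some.comp (primrec_output.comp h)) (Primrec.const none)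

lemma mem_searchStage {i : Input} {n : ℕ} {o : Output} :
    o ∈ searchStage i n ↔
      ∃ c : Certificate, c ∈ (Encodable.decode n : Option Certificate) ∧ c.Valid i ∧
        c.output i = o := by
  classical
  simp only [searchStage, Option.mem_def, Option.bind_eq_some_iff]
  refine exists_congr fun c => and_congr_right fun _ => ?_
  split_ifs with h <;> simp [h]

/-- The algorithm: enumerate the right-reversing runs on the input until one shows success,
failure or eventual periodicity. -/
noncomputable def reversingAlgorithm (i : Input) : Part Output := Nat.rfindOpt (searchStage i)

lemma partrec_reversingAlgorithm : Partrec reversingAlgorithm :=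
  Partrec.rfindOpt primrec_searchStage.to_comp

lemma isReversingOutput_of_mem_reversingAlgorithm {R : Relations ℕ} {u v : List ℕ} {o : Output}
    (h : o ∈ reversingAlgorithm (R, u, v)) : IsReversingOutput id R u v o := by
  obtain ⟨n, hn⟩ := Nat.rfindOpt_spec h
  obtain ⟨c, -, hc⟩ := mem_searchStage.1 hn
  exact isReversingOutput_iff_exists_certificate.2 ⟨c, hc⟩

/-- The code of any valid certificate is a stage at which the search returns a value. -/
lemma reversingAlgorithm_dom_iff {R : Relations ℕ} {u v : List ℕ} :
    (reversingAlgorithm (R, u, v)).Dom ↔ ∃ o, IsReversingOutput id R u v o := by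
  refine ⟨fun h => ⟨_, isReversingOutput_of_mem_reversingAlgorithm (Part.get_mem h)⟩, ?_⟩
  rintro ⟨o, ho⟩
  obtain ⟨c, hc⟩ := isReversingOutput_iff_exists_certificate.1 ho
  exact Nat.rfindOpt_dom.2 ⟨Encodable.encode c, o,
    mem_searchStage.2 ⟨c, by simp, hc⟩⟩

end Primrec

end RightReversing

theorem mainTheorem2 :
    ∃ A : Input →. Output, Partrec A ∧
      ∀ (S : Type*) [Finite S] (name : S → ℕ), Function.Injective name →
        ∀ R : Relations S, IsRightComplemented R →
          (∀ u v : List S,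
            (∀ o ∈ A (input name R u v), IsReversingOutput name R u v o) ∧
            ((A (input name R u v)).Dom ↔
              Failing R u v ∨ EventuallyPeriodic R u v ∨ Succeeds R u v)) ∧
          (IsReversingComplete R → IsNoetherianMonoid (PMonoid R) →
            (∃ G : Set (PMonoid R), G.Finite ∧ IsGarsideFamily G) →
              ∀ u v : List S, ∃ o ∈ A (input name R u v), IsCorrectOutput name R u v o) := by
  refine ⟨reversingAlgorithm, partrec_reversingAlgorithm, fun S _ name hn R hR => ?_⟩
  have hout : ∀ u v : List S, ∀ o ∈ reversingAlgorithm (input name R u v),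
      IsReversingOutput name R u v o := fun u v o ho =>
    -- By definition, `input name R u v` is the triple of `nameRelations name R` and the two named
    -- words.
    (isReversingOutput_nameRelations hn).1 (isReversingOutput_of_mem_reversingAlgorithm ho)
  have hdom : ∀ u v : List S, (reversingAlgorithm (input name R u v)).Dom ↔
      Failing R u v ∨ EventuallyPeriodic R u v ∨ Succeeds R u v := fun u v => by
    rw [← exists_isReversingOutput_iff name u v]
    exact reversingAlgorithm_dom_iff.trans
      (exists_congr fun o => isReversingOutput_nameRelations hn)
  refine ⟨fun u v => ⟨hout u v, hdom u v⟩, ?_⟩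
  rintro hC hN ⟨G, hfin, hG⟩ u v
  have h := (hdom u v).2 (failing_or_eventuallyPeriodic_or_succeeds
    (finite_remainders hR hC hN hfin hG) u v)
  exact ⟨_, Part.get_mem h, (hout u v _ (Part.get_mem h)).isCorrectOutput hR hC⟩
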